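/- Conventions. Let $\Gamma$ be an abelian group and let $A$ and $B$ be unital $\Gamma$-graded rings. $Mod\text{-}A_0$ is the category of right modules over the degree-zero subring $A_0$, and $Gr\text{-}A$ is the category of $\Gamma$-graded right $A$-modules with degree-preserving homomorphisms. For $\alpha\in\Gamma$ the suspension functor $\mathcal T_\alpha$ sends $M$ to $M(\alpha)$, where $M(\alpha)_\gamma=M_{\alpha+\gamma}$, and is the identity on morphisms. A functor $\phi:Gr\text{-}A\to Gr\text{-}B$ is graded if $\phi\circ\mathcal T_\alpha=\mathcal T_\alpha\circ\phi$ for all $\alpha\in\Gamma$; it is a graded equivalence if, moreover, there is a graded functor $\psi:Gr\text{-}B\to Gr\text{-}A$ such that $\psi\circ\phi$ and $\phi\circ\psi$ are naturally isomorphic to the identity functors. For a right $A_0$-module $M$, grade $M\otimes_{A_0}A$ by $(M\otimes_{A_0}A)_\gamma=M\otimes_{A_0}A_\gamma$. The graded rings $A$ and $B$ are homogeneously graded equivalent if there are a graded equivalence $\psi:Gr\text{-}A\to Gr\text{-}B$ and an equivalence of categories $\eta:Mod\text{-}A_0\to Mod\text{-}B_0$ such that $\psi(M\otimes_{A_0}A)\cong\eta(M)\otimes_{B_0}B$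 in $Gr\text{-}B$ for every right $A_0$-module $M$. For a field $k$ and a finite directed graph $E$ (parallel edges allowed; an edge $e$ has source $s(e)$ and range $r(e)$), the Leavitt path algebra $L_k(E)$ is the $k$-algebra generated by the vertices $v$, the edges $e$ and ghost edges $e^*$, subject to $vw=\delta_{v,w}v$; $s(e)e=e=e\,r(e)$; $r(e)e^*=e^*=e^*s(e)$; $e^*f=\delta_{e,f}r(e)$; and $v=\sum_{s(e)=v}ee^*$ for every vertex $v$ that emits an edge. It is unital with $1=\sum_v v$, and it is $\mathbb Z$-graded by placing vertices in degree $0$, edges in degree $1$ and ghost edges in degree $-1$. A sink is a vertex emitting no edges, and paths of length $0$ are the vertices. Statement. Let $k$ be a field, and let $E$ and $F$ be finite acyclic directed graphs such that $E$ has exactly one sink $v$ and $F$ has exactly one sink $w$. Then the maxima below exist, and the $\mathbb Z$-graded rings $L_k(E)$ and $L_k(F)$ are homogeneously graded equivalent if and only if $$\max\{\operatorname{length}(\mu):\mu\in\mathrm{Path}(E),\ r(\mu)=v\}=\max\{\operatorname{length}(\nu):\nu\in\mathrm{Path}(F),\ r(\nu)=w\}.$$ -/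

import Mathlib

universe u

open CategoryTheory TensorProduct

/-! ## Graded right modules over a graded ring

A right `A`-module is a module over `Aᵐᵒᵖ`, so `Mod-A` is `ModuleCat Aᵐᵒᵖ`, and
`MulOpposite.op a • m` is the element usually written `m a`. -/

section GradedModules

theorem GrMod.of_congr {Γ : Type*} [DecidableEq Γ] {M : Type u} [AddCommGroup M] (ℳ : Γ → AddSubgroup M) {i j : Γ} (h : i = j) (y : M)
    (hi : y ∈ ℳ i) (hj : y ∈ ℳ j) :
    DirectSum.of (fun i => ℳ i) i ⟨y, hi⟩ = DirectSum.of (fun i => ℳ i) j ⟨y, hj⟩ := by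
  subst h
  rfl

variable {Γ : Type*} [AddCommGroup Γ] [DecidableEq Γ]
variable {A : Type u} [Ring A] {σ : Type*} [SetLike σ A] [AddSubgroupClass σ A]

/-- A `Γ`-graded right module over the `Γ`-graded ring `A = ⨁ γ, 𝒜 γ`: a right `A`-module which is
the internal direct sum of additive subgroups `M γ` with `M γ * A δ ⊆ M (γ + δ)`. -/
structure GrMod (𝒜 : Γ → σ) [GradedRing 𝒜] where
  carrier : Type u
  [addCommGroup : AddCommGroup carrier]
  [module : Module Aᵐᵒᵖ carrier]
  /-- the homogeneous components -/
  component : Γ → AddSubgroup carrier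
  isInternal : DirectSum.IsInternal component
  smul_mem : ∀ {γ δ : Γ} {m : carrier} {a : A}, m ∈ component γ → a ∈ 𝒜 δ →
    MulOpposite.op a • m ∈ component (γ + δ)

namespace GrMod

attribute [instance] addCommGroup module

variable {𝒜 : Γ → σ} [GradedRing 𝒜]

/-- A graded homomorphism: a homomorphism of right `A`-modules that preserves degrees. -/
@[ext]
structure Hom (M N : GrMod 𝒜) where
  toLinearMap : M.carrier →ₗ[Aᵐᵒᵖ] N.carrier
  map_mem : ∀ (γ : Γ) (m : M.carrier), m ∈ M.component γ → toLinearMap m ∈ N.component γ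

/-- The category `Gr-A` of graded right `A`-modules and graded homomorphisms. -/
instance : Category (GrMod 𝒜) where
  Hom M N := Hom M N
  id M := ⟨LinearMap.id, fun _ _ h => h⟩
  comp f g := ⟨g.toLinearMap ∘ₗ f.toLinearMap, fun γ _ h => g.map_mem γ _ (f.map_mem γ _ h)⟩

theorem isInternal_shift {M : Type u} [AddCommGroup M] (ℳ : Γ → AddSubgroup M)
    (h : DirectSum.IsInternal ℳ) (α : Γ) : DirectSum.IsInternal fun γ => ℳ (α + γ) := by
  let _ := h.chooseDecomposition
  let incl (i : Γ) : ℳ i →+ ℳ (α + (-α + i)) :=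
    AddSubgroup.inclusion (by rw [add_neg_cancel_left])
  let t : (DirectSum Γ fun i => ℳ i) →+ DirectSum Γ fun γ => ℳ (α + γ) :=
    DirectSum.toAddMonoid fun i =>
      (DirectSum.of (fun γ => ℳ (α + γ)) (-α + i)).comp (incl i)
  have ht : ∀ (i : Γ) (y : ℳ i), t (DirectSum.of (fun i => ℳ i) i y) =
      DirectSum.of (fun γ => ℳ (α + γ)) (-α + i) (incl i y) := fun i y =>
    DirectSum.toAddMonoid_of _ _ _
  refine (DirectSum.Decomposition.ofAddHom (fun γ => ℳ (α + γ))
    (t.comp (DirectSum.decomposeAddEquiv ℳ).toAddMonoidHom) ?_ ?_).isInternal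
  · ext x
    change DirectSum.coeAddMonoidHom (fun γ => ℳ (α + γ)) (t (DirectSum.decompose ℳ x)) = x
    induction x using DirectSum.Decomposition.inductionOn ℳ with
    | zero => rw [DirectSum.decompose_zero, map_zero, map_zero]
    | @homogeneous i y =>
      rw [DirectSum.decompose_coe, ht, DirectSum.coeAddMonoidHom_of]
      rfl
    | add x y hx hy => rw [DirectSum.decompose_add, map_add, map_add, hx, hy]
  · refine DirectSum.addHom_ext fun j y => ?_
    rw [AddMonoidHom.comp_apply, DirectSum.coeAddMonoidHom_of, AddMonoidHom.id_apply]
    change t (DirectSum.decompose ℳ (y : M)) = _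
    rw [DirectSum.decompose_of_mem ℳ y.2, ht]
    exact of_congr (fun γ => ℳ (α + γ)) (neg_add_cancel_left α j) (y : M) _ y.2

/-- The suspension functor `𝒯_α`, sending `M` to `M(α)` with `M(α)_γ = M_{α + γ}` and being the
identity on morphisms. -/
def suspension (𝒜 : Γ → σ) [GradedRing 𝒜] (α : Γ) : GrMod 𝒜 ⥤ GrMod 𝒜 where
  obj M :=
    { carrier := M.carrier
      component := fun γ => M.component (α + γ)
      isInternal := isInternal_shift _ M.isInternal α
      smul_mem := fun hm ha => by
        rw [← add_assoc]
        exact M.smul_mem hm ha }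
  map f := ⟨f.toLinearMap, fun γ m h => f.map_mem (α + γ) m h⟩

/-! ### The graded module `M ⊗_{A₀} A` -/

variable (𝒜) in
/-- The submodule of the right `A`-module `A ⊗_ℤ M` (with `A` acting on the factor `A`) by which one
divides to obtain `M ⊗_{A₀} A`; the factors are written in the opposite order. -/
def balancedRel (M : ModuleCat.{u} (𝒜 0)ᵐᵒᵖ) : Submodule Aᵐᵒᵖ (A ⊗[ℤ] M) :=
  Submodule.span Aᵐᵒᵖ
    {x | ∃ (r : 𝒜 0) (a : A) (m : M), x = ((r : A) * a) ⊗ₜ[ℤ] m - a ⊗ₜ[ℤ] (MulOpposite.op r • m)}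

variable (𝒜) in
/-- The right `A`-module `M ⊗_{A₀} A`, for a right `A₀`-module `M`. -/
abbrev BalancedTensor (M : ModuleCat.{u} (𝒜 0)ᵐᵒᵖ) : Type u :=
  (A ⊗[ℤ] M) ⧸ balancedRel 𝒜 M

variable (𝒜) in
/-- The element `m ⊗ a` of `M ⊗_{A₀} A`. -/
def btmul (M : ModuleCat.{u} (𝒜 0)ᵐᵒᵖ) (m : M) (a : A) : BalancedTensor 𝒜 M :=
  Submodule.Quotient.mk (a ⊗ₜ[ℤ] m)

variable (𝒜) in
/-- The component `M ⊗_{A₀} A_γ` of `M ⊗_{A₀} A`. -/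
def btComponent (M : ModuleCat.{u} (𝒜 0)ᵐᵒᵖ) (γ : Γ) : AddSubgroup (BalancedTensor 𝒜 M) :=
  AddSubgroup.closure {x | ∃ (m : M) (a : A), a ∈ 𝒜 γ ∧ x = btmul 𝒜 M m a}

theorem btmul_mem (M : ModuleCat.{u} (𝒜 0)ᵐᵒᵖ) (m : M) {γ : Γ} {a : A} (ha : a ∈ 𝒜 γ) :
    btmul 𝒜 M m a ∈ btComponent 𝒜 M γ :=
  AddSubgroup.subset_closure ⟨m, a, ha, rfl⟩

theorem btmul_add (M : ModuleCat.{u} (𝒜 0)ᵐᵒᵖ) (m : M) (a b : A) :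
    btmul 𝒜 M m (a + b) = btmul 𝒜 M m a + btmul 𝒜 M m b := by
  simp [btmul, TensorProduct.add_tmul]

theorem btmul_zero (M : ModuleCat.{u} (𝒜 0)ᵐᵒᵖ) (m : M) : btmul 𝒜 M m 0 = 0 := by
  simp [btmul]

theorem btmul_add_left (M : ModuleCat.{u} (𝒜 0)ᵐᵒᵖ) (m n : M) (a : A) :
    btmul 𝒜 M (m + n) a = btmul 𝒜 M m a + btmul 𝒜 M n a := by
  simp [btmul, TensorProduct.tmul_add]

theorem btmul_balanced (M : ModuleCat.{u} (𝒜 0)ᵐᵒᵖ) (r : 𝒜 0) (m : M) (a : A) :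
    btmul 𝒜 M m ((r : A) * a) = btmul 𝒜 M (MulOpposite.op r • m) a :=
  (Submodule.Quotient.eq _).2 (Submodule.subset_span ⟨r, a, m, rfl⟩)

theorem op_smul_btmul (M : ModuleCat.{u} (𝒜 0)ᵐᵒᵖ) (m : M) (a b : A) :
    MulOpposite.op b • btmul 𝒜 M m a = btmul 𝒜 M m (a * b) := rfl

/-- Additive maps out of `M ⊗_{A₀} A` from balanced biadditive maps. -/
def btLift (M : ModuleCat.{u} (𝒜 0)ᵐᵒᵖ) {B : Type*} [AddCommGroup B] (f : A →+ M →+ B)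
    (hf : ∀ (r : 𝒜 0) (a : A) (m : M), f ((r : A) * a) m = f a (MulOpposite.op r • m)) :
    BalancedTensor 𝒜 M →+ B :=
  QuotientAddGroup.lift (balancedRel 𝒜 M).toAddSubgroup
    (TensorProduct.liftAddHom f (fun (r : ℤ) a m => by
      rw [map_zsmul, map_zsmul, AddMonoidHom.zsmul_apply])) (by
      intro x hx
      have : ∀ c : Aᵐᵒᵖ, TensorProduct.liftAddHom f (fun (r : ℤ) a m => by
          rw [map_zsmul, map_zsmul, AddMonoidHom.zsmul_apply]) (c • x) = 0 := by
        change x ∈ balancedRel 𝒜 M at hx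
        unfold balancedRel at hx
        induction hx using Submodule.span_induction with
        | mem x h =>
          obtain ⟨r, a, m, rfl⟩ := h
          intro c
          rw [smul_sub, TensorProduct.smul_tmul', TensorProduct.smul_tmul', map_sub,
            TensorProduct.liftAddHom_tmul, TensorProduct.liftAddHom_tmul, ← MulOpposite.op_unop c,
            op_smul_eq_mul, op_smul_eq_mul, mul_assoc, hf, sub_self]
        | zero => intro c; simp
        | add x y _ _ hx hy => intro c; rw [smul_add, map_add, hx, hy, add_zero]
        | smul b x _ hx => intro c; rw [← mul_smul]; exact hx _
      simpa using this 1)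

theorem btLift_btmul (M : ModuleCat.{u} (𝒜 0)ᵐᵒᵖ) {B : Type*} [AddCommGroup B] (f : A →+ M →+ B)
    (hf : ∀ (r : 𝒜 0) (a : A) (m : M), f ((r : A) * a) m = f a (MulOpposite.op r • m))
    (m : M) (a : A) : btLift M f hf (btmul 𝒜 M m a) = f a m := rfl

theorem bt_addHom_ext (M : ModuleCat.{u} (𝒜 0)ᵐᵒᵖ) {B : Type*} [AddCommGroup B]
    {f g : BalancedTensor 𝒜 M →+ B} (h : ∀ m a, f (btmul 𝒜 M m a) = g (btmul 𝒜 M m a)) :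
    f = g := by
  ext x
  obtain ⟨x, rfl⟩ := Submodule.Quotient.mk_surjective _ x
  induction x using TensorProduct.induction_on with
  | zero => rw [Submodule.Quotient.mk_zero, map_zero, map_zero]
  | tmul a m => exact h m a
  | add x y hx hy => rw [Submodule.Quotient.mk_add, map_add, map_add, hx, hy]

/-- The map `A_γ → M → M ⊗_{A₀} A_γ`. -/
def btPart (M : ModuleCat.{u} (𝒜 0)ᵐᵒᵖ) (γ : Γ) : 𝒜 γ →+ M →+ btComponent 𝒜 M γ :=
  AddMonoidHom.mk'
    (fun a => AddMonoidHom.mk' (fun m => ⟨btmul 𝒜 M m a, btmul_mem M m a.2⟩)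
      (fun m n => Subtype.ext (btmul_add_left M m n a)))
    (fun a b => by ext m; exact btmul_add M m a b)

/-- The map `(m, a) ↦ ∑ γ, m ⊗ a_γ` into the direct sum of the components. -/
def btSplit (M : ModuleCat.{u} (𝒜 0)ᵐᵒᵖ) : A →+ M →+ DirectSum Γ fun γ => btComponent 𝒜 M γ :=
  (DirectSum.toAddMonoid fun γ =>
    (AddMonoidHom.compHom (DirectSum.of (fun γ => btComponent 𝒜 M γ) γ)).comp (btPart M γ)).comp
    (DirectSum.decomposeAddEquiv 𝒜).toAddMonoidHom

theorem btSplit_hom (M : ModuleCat.{u} (𝒜 0)ᵐᵒᵖ) (γ : Γ) (a : A) (ha : a ∈ 𝒜 γ) (m : M) :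
    btSplit M a m =
      DirectSum.of (fun γ => btComponent 𝒜 M γ) γ ⟨btmul 𝒜 M m a, btmul_mem M m ha⟩ := by
  have : DirectSum.decomposeAddEquiv 𝒜 a = DirectSum.of (fun γ => 𝒜 γ) γ ⟨a, ha⟩ :=
    DirectSum.decompose_of_mem 𝒜 ha
  unfold btSplit
  rw [AddMonoidHom.comp_apply, AddEquiv.toAddMonoidHom_eq_coe, AddMonoidHom.coe_coe, this,
    DirectSum.toAddMonoid_of]
  rfl

theorem btSplit_balanced (M : ModuleCat.{u} (𝒜 0)ᵐᵒᵖ) (r : 𝒜 0) (a : A) (m : M) :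
    btSplit M ((r : A) * a) m = btSplit M a (MulOpposite.op r • m) := by
  induction a using DirectSum.Decomposition.inductionOn 𝒜 with
  | zero => rw [mul_zero, map_zero, AddMonoidHom.zero_apply, AddMonoidHom.zero_apply]
  | @homogeneous γ a =>
    have hra : (r : A) * a ∈ 𝒜 γ := by
      have := SetLike.GradedMul.mul_mem r.2 a.2
      rwa [zero_add] at this
    rw [btSplit_hom M γ _ hra, btSplit_hom M γ _ a.2]
    exact congrArg _ (Subtype.ext (btmul_balanced M r m a))
  | add a b ha hb =>
    rw [mul_add, map_add, map_add, AddMonoidHom.add_apply, ha, hb, AddMonoidHom.add_apply]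

theorem coe_btSplit (M : ModuleCat.{u} (𝒜 0)ᵐᵒᵖ) (a : A) (m : M) :
    DirectSum.coeAddMonoidHom (btComponent 𝒜 M) (btSplit M a m) = btmul 𝒜 M m a := by
  induction a using DirectSum.Decomposition.inductionOn 𝒜 with
  | zero => rw [map_zero, AddMonoidHom.zero_apply, map_zero, btmul_zero]
  | @homogeneous γ a => rw [btSplit_hom M γ _ a.2, DirectSum.coeAddMonoidHom_of]
  | add a b ha hb => rw [map_add, AddMonoidHom.add_apply, map_add, ha, hb, btmul_add]

theorem btLift_btSplit (M : ModuleCat.{u} (𝒜 0)ᵐᵒᵖ) (γ : Γ) (y : BalancedTensor 𝒜 M)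
    (hy : y ∈ btComponent 𝒜 M γ) :
    btLift M (btSplit M) (btSplit_balanced M) y =
      DirectSum.of (fun γ => btComponent 𝒜 M γ) γ ⟨y, hy⟩ := by
  refine AddSubgroup.closure_induction (p := fun y hy =>
    btLift M (btSplit M) (btSplit_balanced M) y =
      DirectSum.of (fun γ => btComponent 𝒜 M γ) γ ⟨y, hy⟩) ?_ ?_ ?_ ?_ hy
  · rintro _ ⟨m, a, ha, rfl⟩
    rw [btLift_btmul, btSplit_hom M γ a ha]
  · rw [map_zero]
    exact (map_zero _).symm
  · intro x y hx hy h₁ h₂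
    rw [map_add, h₁, h₂, ← map_add]
    rfl
  · intro x hx h
    rw [map_neg, h, ← map_neg]
    rfl

theorem btComponent_isInternal (M : ModuleCat.{u} (𝒜 0)ᵐᵒᵖ) :
    DirectSum.IsInternal (btComponent 𝒜 M) := by
  refine (DirectSum.Decomposition.ofAddHom (btComponent 𝒜 M)
    (btLift M (btSplit M) (btSplit_balanced M)) ?_ ?_).isInternal
  · refine bt_addHom_ext M fun m a => ?_
    rw [AddMonoidHom.comp_apply, btLift_btmul, AddMonoidHom.id_apply, coe_btSplit]
  · refine DirectSum.addHom_ext fun γ y => ?_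
    rw [AddMonoidHom.comp_apply, DirectSum.coeAddMonoidHom_of, AddMonoidHom.id_apply]
    exact btLift_btSplit M γ y y.2

/-- The graded right `A`-module `M ⊗_{A₀} A` of a right `A₀`-module `M`. -/
def tensorObj (𝒜 : Γ → σ) [GradedRing 𝒜] (M : ModuleCat.{u} (𝒜 0)ᵐᵒᵖ) : GrMod 𝒜 where
  carrier := BalancedTensor 𝒜 M
  component := btComponent 𝒜 M
  isInternal := btComponent_isInternal M
  smul_mem := by
    intro γ δ x b hx hb
    unfold btComponent at hx
    induction hx using AddSubgroup.closure_induction with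
    | mem x h =>
      obtain ⟨m, a, ha, rfl⟩ := h
      rw [op_smul_btmul]
      exact btmul_mem M m (SetLike.GradedMul.mul_mem ha hb)
    | zero => rw [smul_zero]; exact zero_mem _
    | add x y _ _ hx hy => rw [smul_add]; exact add_mem hx hy
    | neg x _ hx => rw [smul_neg]; exact neg_mem hx

end GrMod

section Equivalences

variable {B : Type u} [Ring B] {τ : Type*} [SetLike τ B] [AddSubgroupClass τ B]
variable {𝒜 : Γ → σ} [GradedRing 𝒜] {ℬ : Γ → τ} [GradedRing ℬ]

/-- A functor `Gr-A ⥤ Gr-B` is graded if it commutes with all suspension functors. -/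
def IsGradedFunctor (φ : GrMod 𝒜 ⥤ GrMod ℬ) : Prop :=
  ∀ α : Γ, GrMod.suspension 𝒜 α ⋙ φ = φ ⋙ GrMod.suspension ℬ α

/-- A graded equivalence: a graded functor with a graded quasi-inverse. -/
def IsGradedEquivalence (φ : GrMod 𝒜 ⥤ GrMod ℬ) : Prop :=
  IsGradedFunctor φ ∧ ∃ ψ : GrMod ℬ ⥤ GrMod 𝒜, IsGradedFunctor ψ ∧
    Nonempty (φ ⋙ ψ ≅ 𝟭 (GrMod 𝒜)) ∧ Nonempty (ψ ⋙ φ ≅ 𝟭 (GrMod ℬ))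

variable (𝒜 ℬ) in
/-- The graded rings `A` and `B` are homogeneously graded equivalent: there are a graded equivalence
`ψ : Gr-A ⥤ Gr-B` and an equivalence `η : Mod-A₀ ⥤ Mod-B₀` with `ψ (M ⊗_{A₀} A) ≅ η M ⊗_{B₀} B` in
`Gr-B` for every right `A₀`-module `M`. -/
def HomogeneouslyGradedEquivalent : Prop :=
  ∃ ψ : GrMod 𝒜 ⥤ GrMod ℬ, IsGradedEquivalence ψ ∧
    ∃ η : ModuleCat.{u} (𝒜 0)ᵐᵒᵖ ⥤ ModuleCat.{u} (ℬ 0)ᵐᵒᵖ, η.IsEquivalence ∧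
      ∀ M : ModuleCat.{u} (𝒜 0)ᵐᵒᵖ,
        Nonempty (ψ.obj (GrMod.tensorObj 𝒜 M) ≅ GrMod.tensorObj ℬ (η.obj M))

end Equivalences

end GradedModules

/-! ## Leavitt path algebras of finite graphs

A (directed) graph is a quiver; `a ⟶ b` is the type of edges with source `a` and range `b`. -/

namespace LeavittPathAlgebra

/-- The generators: vertices `v`, edges `e`, and ghost edges `e*`. -/
inductive Gen (E : Type u) [Quiver.{u} E] : Type u
  | vertex (v : E)
  | edge (e : Quiver.Total E)
  | ghost (e : Quiver.Total E)

namespace Gen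

variable {E : Type u} [Quiver.{u} E]

/-- The degree of a generator. -/
def deg : Gen E → ℤ
  | vertex _ => 0
  | edge _ => 1
  | ghost _ => -1

end Gen

section

variable (k E : Type u) [Field k] [Quiver.{u} E]

/-- A generator, as an element of the free unital algebra. -/
abbrev gen (x : Gen E) : FreeAlgebra k (Gen E) := FreeAlgebra.ι k x

variable [Fintype E] [∀ a b : E, Fintype (a ⟶ b)]

/-- The defining relations. The last one says that the sum of the finitely many vertices is the
identity of the algebra, which holds in the (automatically unital) Leavitt path algebra of a finite
graph. -/
inductive Rel : FreeAlgebra k (Gen E) → FreeAlgebra k (Gen E) → Prop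
  | vertex_mul_self (v : E) : Rel (gen k E (.vertex v) * gen k E (.vertex v)) (gen k E (.vertex v))
  | vertex_mul_of_ne (v w : E) (h : v ≠ w) : Rel (gen k E (.vertex v) * gen k E (.vertex w)) 0
  | source_mul_edge (e : Quiver.Total E) :
      Rel (gen k E (.vertex e.left) * gen k E (.edge e)) (gen k E (.edge e))
  | edge_mul_range (e : Quiver.Total E) :
      Rel (gen k E (.edge e) * gen k E (.vertex e.right)) (gen k E (.edge e))
  | range_mul_ghost (e : Quiver.Total E) :
      Rel (gen k E (.vertex e.right) * gen k E (.ghost e)) (gen k E (.ghost e))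
  | ghost_mul_source (e : Quiver.Total E) :
      Rel (gen k E (.ghost e) * gen k E (.vertex e.left)) (gen k E (.ghost e))
  | ck1_self (e : Quiver.Total E) :
      Rel (gen k E (.ghost e) * gen k E (.edge e)) (gen k E (.vertex e.right))
  | ck1_of_ne (e f : Quiver.Total E) (h : e ≠ f) :
      Rel (gen k E (.ghost e) * gen k E (.edge f)) 0
  | ck2 (v : E) (h : ∃ w : E, Nonempty (v ⟶ w)) :
      Rel (∑ w : E, ∑ e : v ⟶ w, gen k E (.edge ⟨v, w, e⟩) * gen k E (.ghost ⟨v, w, e⟩))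
        (gen k E (.vertex v))
  | sum_vertex : Rel (∑ v : E, gen k E (.vertex v)) 1

end

end LeavittPathAlgebra

/-- The Leavitt path algebra `L_k(E)` of a finite graph `E`. -/
abbrev LeavittPathAlgebra (k E : Type u) [Field k] [Quiver.{u} E] [Fintype E]
    [∀ a b : E, Fintype (a ⟶ b)] : Type u :=
  RingQuot (LeavittPathAlgebra.Rel k E)

namespace LeavittPathAlgebra

variable (k E : Type u) [Field k] [Quiver.{u} E] [Fintype E] [∀ a b : E, Fintype (a ⟶ b)]

/-- A generator, as an element of `L_k(E)`. -/
def mkGen (x : Gen E) : LeavittPathAlgebra k E :=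
  RingQuot.mkAlgHom k (Rel k E) (gen k E x)

/-- The standard `ℤ`-grading of `L_k(E)`, with vertices in degree `0`, edges in degree `1` and ghost
edges in degree `-1`: the component of degree `n` is spanned by the products of generators of total
degree `n`. -/
def grading (n : ℤ) : Submodule k (LeavittPathAlgebra k E) :=
  Submodule.span k
    {x | ∃ l : List (Gen E), (l.map Gen.deg).sum = n ∧ x = (l.map (mkGen k E)).prod}

variable {k E} in
theorem mkGen_mem (x : Gen E) : mkGen k E x ∈ grading k E x.deg :=
  Submodule.subset_span ⟨[x], by simp, by simp⟩

instance gradedMonoid : SetLike.GradedMonoid (grading k E) where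
  one_mem := Submodule.subset_span ⟨[], by simp, by simp⟩
  mul_mem := by
    intro i j x y hx hy
    have h := Submodule.mul_mem_mul hx hy
    unfold grading at h
    rw [Submodule.span_mul_span] at h
    refine Submodule.span_mono ?_ h
    rintro _ ⟨_, ⟨l, hl, rfl⟩, _, ⟨l', hl', rfl⟩, rfl⟩
    exact ⟨l ++ l', by simp [hl, hl'], by simp⟩

/-- A generator, as a homogeneous element of the direct sum of the components. -/
noncomputable def homGen (x : Gen E) : DirectSum ℤ fun n => grading k E n :=
  DirectSum.of (fun n => grading k E n) x.deg ⟨mkGen k E x, mkGen_mem x⟩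

theorem homGen_mul {x y : Gen E} (n : ℤ) (hn : x.deg + y.deg = n)
    (h : mkGen k E x * mkGen k E y ∈ grading k E n) :
    homGen k E x * homGen k E y =
      DirectSum.of (fun n => grading k E n) n ⟨mkGen k E x * mkGen k E y, h⟩ := by
  subst hn
  exact DirectSum.of_mul_of _ _

theorem homGen_mul_eq {x y z : Gen E} (hd : x.deg + y.deg = z.deg)
    (h : mkGen k E x * mkGen k E y = mkGen k E z) :
    homGen k E x * homGen k E y = homGen k E z := by
  rw [homGen_mul k E z.deg hd (h ▸ mkGen_mem z)]
  exact congrArg _ (Subtype.ext h)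

theorem homGen_mul_eq_zero {x y : Gen E} (h : mkGen k E x * mkGen k E y = 0) :
    homGen k E x * homGen k E y = 0 := by
  rw [homGen_mul k E _ rfl (h ▸ zero_mem _)]
  exact (congrArg _ (Subtype.ext h)).trans (map_zero _)

theorem of_sum {ι : Type*} (s : Finset ι) (n : ℤ) (x : ι → LeavittPathAlgebra k E)
    (hx : ∀ i, x i ∈ grading k E n) :
    ∑ i ∈ s, DirectSum.of (fun n => grading k E n) n ⟨x i, hx i⟩ =
      DirectSum.of (fun n => grading k E n) n ⟨∑ i ∈ s, x i, sum_mem fun i _ => hx i⟩ := by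
  classical
  induction s using Finset.induction_on with
  | empty => exact (map_zero _).symm
  | insert a s ha ih =>
    rw [Finset.sum_insert ha, ih, ← map_add]
    exact congrArg _ (Subtype.ext (Finset.sum_insert ha).symm)

theorem homGen_ck2 (v : E) (h : ∑ w : E, ∑ e : v ⟶ w,
      mkGen k E (.edge ⟨v, w, e⟩) * mkGen k E (.ghost ⟨v, w, e⟩) = mkGen k E (.vertex v)) :
    ∑ w : E, ∑ e : v ⟶ w, homGen k E (.edge ⟨v, w, e⟩) * homGen k E (.ghost ⟨v, w, e⟩) =
      homGen k E (.vertex v) := by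
  have hm : ∀ (w : E) (e : v ⟶ w),
      mkGen k E (.edge ⟨v, w, e⟩) * mkGen k E (.ghost ⟨v, w, e⟩) ∈ grading k E 0 := by
    intro w e
    have := SetLike.GradedMul.mul_mem (A := grading k E) (mkGen_mem (.edge ⟨v, w, e⟩))
      (mkGen_mem (.ghost ⟨v, w, e⟩))
    simp only [Gen.deg, add_neg_cancel] at this
    exact this
  have h₁ : ∀ w : E, ∑ e : v ⟶ w, homGen k E (.edge ⟨v, w, e⟩) * homGen k E (.ghost ⟨v, w, e⟩) =
      DirectSum.of (fun n => grading k E n) 0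
        ⟨∑ e : v ⟶ w, mkGen k E (.edge ⟨v, w, e⟩) * mkGen k E (.ghost ⟨v, w, e⟩),
          sum_mem fun e _ => hm w e⟩ := by
    intro w
    rw [← of_sum k E Finset.univ 0 _ (hm w)]
    exact Finset.sum_congr rfl fun e _ => homGen_mul k E 0 rfl (hm w e)
  rw [Finset.sum_congr rfl fun w _ => h₁ w, of_sum]
  exact congrArg _ (Subtype.ext h)

theorem homGen_sum_vertex (h : ∑ v : E, mkGen k E (.vertex v) = 1) :
    ∑ v : E, homGen k E (.vertex v) = 1 := by
  have := of_sum k E Finset.univ 0 (fun v : E => mkGen k E (.vertex v))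
    fun v => mkGen_mem (.vertex v)
  exact this.trans (congrArg _ (Subtype.ext h))

theorem homGen_rel {a b : FreeAlgebra k (Gen E)} (h : Rel k E a b) :
    FreeAlgebra.lift k (homGen k E) a = FreeAlgebra.lift k (homGen k E) b := by
  have h' := RingQuot.mkAlgHom_rel k h
  cases h with
  | vertex_mul_self v =>
    simp only [map_mul, FreeAlgebra.lift_ι_apply] at h' ⊢
    exact homGen_mul_eq k E rfl h'
  | vertex_mul_of_ne v w h =>
    simp only [map_mul, map_zero, FreeAlgebra.lift_ι_apply] at h' ⊢
    exact homGen_mul_eq_zero k E h'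
  | source_mul_edge e =>
    simp only [map_mul, FreeAlgebra.lift_ι_apply] at h' ⊢
    exact homGen_mul_eq k E rfl h'
  | edge_mul_range e =>
    simp only [map_mul, FreeAlgebra.lift_ι_apply] at h' ⊢
    exact homGen_mul_eq k E rfl h'
  | range_mul_ghost e =>
    simp only [map_mul, FreeAlgebra.lift_ι_apply] at h' ⊢
    exact homGen_mul_eq k E rfl h'
  | ghost_mul_source e =>
    simp only [map_mul, FreeAlgebra.lift_ι_apply] at h' ⊢
    exact homGen_mul_eq k E rfl h'
  | ck1_self e =>
    simp only [map_mul, FreeAlgebra.lift_ι_apply] at h' ⊢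
    exact homGen_mul_eq k E rfl h'
  | ck1_of_ne e f h =>
    simp only [map_mul, map_zero, FreeAlgebra.lift_ι_apply] at h' ⊢
    exact homGen_mul_eq_zero k E h'
  | ck2 v h =>
    simp only [map_mul, map_sum, FreeAlgebra.lift_ι_apply] at h' ⊢
    exact homGen_ck2 k E v h'
  | sum_vertex =>
    simp only [map_sum, map_one, FreeAlgebra.lift_ι_apply] at h' ⊢
    exact homGen_sum_vertex k E h'

/-- The decomposition of `L_k(E)` into homogeneous components. -/
noncomputable def decomposeHom :
    LeavittPathAlgebra k E →ₐ[k] DirectSum ℤ fun n => grading k E n :=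
  RingQuot.liftAlgHom k ⟨FreeAlgebra.lift k (homGen k E), fun _ _ h => homGen_rel k E h⟩

theorem decomposeHom_mkGen (x : Gen E) : decomposeHom k E (mkGen k E x) = homGen k E x := by
  simp [decomposeHom, mkGen]

theorem decomposeHom_word (l : List (Gen E))
    (h : (l.map (mkGen k E)).prod ∈ grading k E (l.map Gen.deg).sum) :
    decomposeHom k E (l.map (mkGen k E)).prod =
      DirectSum.of (fun n => grading k E n) (l.map Gen.deg).sum ⟨_, h⟩ := by
  induction l with
  | nil => simp only [List.map_nil, List.prod_nil, map_one]; rfl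
  | cons x l ih =>
    have hl : (l.map (mkGen k E)).prod ∈ grading k E (l.map Gen.deg).sum :=
      Submodule.subset_span ⟨l, rfl, rfl⟩
    simp only [List.map_cons, List.prod_cons, map_mul]
    rw [ih hl, decomposeHom_mkGen, homGen, DirectSum.of_mul_of]
    rfl

noncomputable instance gradedAlgebra : GradedAlgebra (grading k E) :=
  GradedAlgebra.ofAlgHom (grading k E) (decomposeHom k E)
    (by
      refine RingQuot.ringQuot_ext' k _ _ (FreeAlgebra.hom_ext (funext fun x => ?_))
      change DirectSum.coeAlgHom (grading k E) (decomposeHom k E (mkGen k E x)) = mkGen k E x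
      rw [decomposeHom_mkGen, homGen, DirectSum.coeAlgHom_of])
    (by
      rintro n ⟨x, hx⟩
      change decomposeHom k E x = _
      induction hx using Submodule.span_induction with
      | mem x h =>
        obtain ⟨l, rfl, rfl⟩ := h
        exact decomposeHom_word k E l _
      | zero => rw [map_zero]; exact (map_zero _).symm
      | add x y hx hy h₁ h₂ =>
        rw [map_add, h₁, h₂, ← map_add]
        rfl
      | smul c x hx h =>
        rw [map_smul, h]
        exact (map_smul (DirectSum.lof k ℤ (fun n => grading k E n) n) c _).symm)

end LeavittPathAlgebra

/-! ## Graph-theoretic notions -/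

/-- A directed graph is acyclic if it has no closed path of positive length. -/
def IsAcyclicGraph (E : Type u) [Quiver.{u} E] : Prop :=
  ∀ (v : E) (p : Quiver.Path v v), p.length = 0

/-- A sink is a vertex that emits no edges. -/
def IsSink {E : Type u} [Quiver.{u} E] (v : E) : Prop :=
  ∀ w : E, IsEmpty (v ⟶ w)

/-- The set of lengths of the paths ending at `v`. -/
def pathLengthsTo {E : Type u} [Quiver.{u} E] (v : E) : Set ℕ :=
  {n | ∃ (a : E) (p : Quiver.Path a v), p.length = n}

/-! Let p and q run over the paths ending at the sink. The products p q* span the Leavitt path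
algebra (`span_unit`): the last relation rewrites a vertex that emits edges through the ranges of
those edges, and acyclicity makes this stop at the sink. The representation on functions on these
paths carries the p q* to matrix units, so `pathMatrixEquiv` identifies L_k(E) with a full matrix
algebra over k, in which by `mem_grading_iff` the unit with indices p, q has degree |p| - |q|. A
suffix of a path ending at the sink again ends there, so the lengths that occur are exactly 0, ...,
m, where m is the maximum.

Necessity. The degree-zero subring of such a matrix algebra is a product of matrix algebras over k,
one for each length that occurs. Its simple modules up to isomorphism are therefore counted by the
lengths (`simpleModule_equiv_iff`, `exists_simpleModule_equiv`), and an equivalence of the module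
categories over the degree-zero subrings preserves their number, m + 1 (`card_image_eq`,
`card_image_length`).

Sufficiency. Equal maxima give equal sets of lengths, hence length-preserving maps f and g between
the two sets of paths, in general not bijective. Through f an element b of L_k(F) becomes a matrix
over L_k(E) with entries b_{qq'} e_{f q, f q'}, and g works in the other direction. A homomorphism Φ
: B → M_Q(A), possibly not unital, defines the functor M ↦ M^Q Φ(1). A row U and a column V with UV
= 1 and VU = Φ(Ψ(1)) make the composite of two such functors isomorphic to the identity
(`CornerUnit`). Since Φ preserves degrees and U, V have degree zero, the construction works for
graded modules and for modules over the degree-zero subrings alike, and `cornerTensorIso` shows that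
it commutes with - ⊗ A. -/

/-! ## Paths ending at a given vertex -/

/-- Paths ending at `v`, built by prepending edges. -/
inductive PathTo {E : Type u} [Quiver.{u} E] (v : E) : E → Type u
  | nil : PathTo v v
  | cons {a b : E} (e : a ⟶ b) (p : PathTo v b) : PathTo v a

namespace PathTo

variable {E : Type u} [Quiver.{u} E] {v : E}

/-- The number of edges of a path. -/
def length : {a : E} → PathTo v a → ℕ
  | _, nil => 0
  | _, cons _ p => p.length + 1

/-- The path as a `Quiver.Path`. -/
def toPath : {a : E} → PathTo v a → Quiver.Path a v
  | _, nil => Quiver.Path.nil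
  | _, cons e p => e.toPath.comp p.toPath

theorem length_toPath {a : E} (p : PathTo v a) : p.toPath.length = p.length := by
  induction p with
  | nil => rfl
  | cons e p ih => simp [toPath, length, ih, add_comm]

/-- Prepending a `Quiver.Path`. -/
def append {a b : E} (p : Quiver.Path a b) (q : PathTo v b) : PathTo v a :=
  match p with
  | Quiver.Path.nil => q
  | Quiver.Path.cons p e => append p (cons e q)

theorem length_append {a b : E} (p : Quiver.Path a b) (q : PathTo v b) :
    (append p q).length = p.length + q.length := by
  induction p with
  | nil => simp [append]
  | cons p e ih => rw [append, ih, length, Quiver.Path.length_cons]; omega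

theorem mem_pathLengthsTo {n : ℕ} :
    n ∈ pathLengthsTo v ↔ ∃ p : Σ a, PathTo v a, p.2.length = n := by
  constructor
  · rintro ⟨a, p, rfl⟩
    exact ⟨⟨a, append p nil⟩, by simp [length_append, length]⟩
  · rintro ⟨⟨a, p⟩, rfl⟩
    exact ⟨a, p.toPath, p.length_toPath⟩

/-- Deleting the first edge keeps the endpoint and lowers the length by one, so the suffixes of `p`
realise every smaller length. -/
theorem exists_length_eq_of_le {a : E} (p : PathTo v a) {n : ℕ} (hn : n ≤ p.length) :
    ∃ q : Σ a, PathTo v a, q.2.length = n := by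
  induction p with
  | nil => exact ⟨⟨v, nil⟩, by simp [length] at hn ⊢; omega⟩
  | @cons a b e p ih =>
    rcases Nat.lt_or_ge p.length n with h | h
    · exact ⟨⟨a, cons e p⟩, by simp only [length] at hn ⊢; omega⟩
    · exact ih h

theorem eq_nil_of_isSink (hv : IsSink v) (p : PathTo v v) : p = nil := by
  cases p with
  | nil => rfl
  | cons e p => exact ((hv _).false e).elim

end PathTo

/-! ### Finite acyclic graphs -/

section Acyclic

variable {E : Type u} [Quiver.{u} E]

/-- Reachability by a path of positive length is transitive, and irreflexive by acyclicity, hence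
well-founded on a finite set. It contains the edge relation. The resulting induction passes from the
ranges of edges to their source. -/
theorem IsAcyclicGraph.wellFounded [Finite E] (hE : IsAcyclicGraph E) :
    WellFounded fun b a : E => Nonempty (a ⟶ b) := by
  let r : E → E → Prop := fun b a => ∃ p : Quiver.Path a b, 0 < p.length
  have : IsTrans E r := ⟨fun a b c ⟨p, hp⟩ ⟨q, hq⟩ => ⟨q.comp p, by simp; omega⟩⟩
  have : Std.Irrefl r := ⟨fun a ⟨p, hp⟩ => hp.ne' (hE a p)⟩
  refine Subrelation.wf (r := r) ?_ (Finite.wellFounded_of_trans_of_irrefl r)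
  rintro b a ⟨e⟩
  exact ⟨e.toPath, by simp⟩

/-- A nontrivial path from `a` is one of finitely many edges followed by a path from its range,
where the induction hypothesis applies. -/
theorem PathTo.finite [Finite E] [∀ a b : E, Finite (a ⟶ b)] (hE : IsAcyclicGraph E) (v a : E) :
    Finite (PathTo v a) := by
  induction a using hE.wellFounded.induction with
  | _ a ih =>
    have (x : Σ b : E, a ⟶ b) : Finite (PathTo v x.1) := ih x.1 ⟨x.2⟩
    let f : Option (Σ x : (Σ b : E, a ⟶ b), PathTo v x.1) → Option (PathTo v a) := fun x =>
      x.map fun y => PathTo.cons y.1.2 y.2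
    by_cases h : a = v
    · subst h
      -- The value `none` stands for the trivial path, which exists only when `a = v`.
      refine Finite.of_surjective (fun x => (f x).getD PathTo.nil) fun p => ?_
      cases p with
      | nil => exact ⟨none, rfl⟩
      | cons e p => exact ⟨some ⟨⟨_, e⟩, p⟩, rfl⟩
    · refine Finite.of_surjective (fun y : Σ x : (Σ b : E, a ⟶ b), PathTo v x.1 =>
        PathTo.cons y.1.2 y.2) fun p => ?_
      cases p with
      | nil => exact (h rfl).elim
      | cons e p => exact ⟨⟨⟨_, e⟩, p⟩, rfl⟩

end Acyclic

/-! ## The representation of a Leavitt path algebra on the paths ending at a sink -/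

namespace LeavittPathAlgebra

variable (k : Type u) {E : Type u} [Field k] [Quiver.{u} E]

section Operators

variable (v : E)

open Classical in
/-- The action of the vertex `u` on functions on the paths ending at `v`. -/
noncomputable def vertexOp (u : E) : Module.End k ((Σ a, PathTo v a) → k) where
  toFun f x := if x.1 = u then f x else 0
  map_add' f g := by ext x; dsimp only [Pi.add_apply]; split_ifs <;> simp
  map_smul' c f := by ext x; simp

/-- The function `p ↦ f p'` if `p = e p'`, and `0` if `p` does not start with `e`. -/
noncomputable def edgeFun (e : Quiver.Total E) (f : (Σ a, PathTo v a) → k) :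
    (Σ a, PathTo v a) → k
  | ⟨_, .nil⟩ => 0
  | ⟨a, @PathTo.cons _ _ _ _ b e' p⟩ => open Classical in
    if (⟨a, b, e'⟩ : Quiver.Total E) = e then f ⟨b, p⟩ else 0

/-- The action of the edge `e` on functions on the paths ending at `v`. -/
noncomputable def edgeOp (e : Quiver.Total E) : Module.End k ((Σ a, PathTo v a) → k) where
  toFun := edgeFun k v e
  map_add' f g := by
    ext ⟨a, p⟩
    cases p <;> simp only [edgeFun, Pi.add_apply, add_zero]
    split_ifs <;> simp
  map_smul' c f := by
    ext ⟨a, p⟩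
    cases p <;> simp [edgeFun]

open Classical in
/-- The action of the ghost edge `e*` on functions on the paths ending at `v`. -/
noncomputable def ghostOp (e : Quiver.Total E) : Module.End k ((Σ a, PathTo v a) → k) where
  toFun f x := if h : x.1 = e.right then f ⟨e.left, .cons e.hom (h ▸ x.2)⟩ else 0
  map_add' f g := by ext x; dsimp only [Pi.add_apply]; split_ifs <;> simp
  map_smul' c f := by ext x; simp

/-- The action of a generator. -/
noncomputable def genOp : Gen E → Module.End k ((Σ a, PathTo v a) → k)
  | .vertex u => vertexOp k v u
  | .edge e => edgeOp k v e
  | .ghost e => ghostOp k v e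

variable {k v}

open Classical in
theorem vertexOp_apply (u : E) (f : (Σ a, PathTo v a) → k) (a : E) (p : PathTo v a) :
    vertexOp k v u f ⟨a, p⟩ = if a = u then f ⟨a, p⟩ else 0 := rfl

theorem edgeOp_nil (e : Quiver.Total E) (f : (Σ a, PathTo v a) → k) :
    edgeOp k v e f ⟨v, .nil⟩ = 0 := rfl

open Classical in
theorem edgeOp_cons (e : Quiver.Total E) (f : (Σ a, PathTo v a) → k) {a b : E} (e' : a ⟶ b)
    (p : PathTo v b) :
    edgeOp k v e f ⟨a, .cons e' p⟩ =
      if (⟨a, b, e'⟩ : Quiver.Total E) = e then f ⟨b, p⟩ else 0 := rfl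

theorem ghostOp_self (e : Quiver.Total E) (f : (Σ a, PathTo v a) → k) (p : PathTo v e.right) :
    ghostOp k v e f ⟨e.right, p⟩ = f ⟨e.left, .cons e.hom p⟩ := by
  simp [ghostOp]

theorem ghostOp_of_ne (e : Quiver.Total E) (f : (Σ a, PathTo v a) → k) {a : E} (p : PathTo v a)
    (h : a ≠ e.right) : ghostOp k v e f ⟨a, p⟩ = 0 := by
  simp [ghostOp, h]

/-- On the indicator function of a path, an edge prepends itself, a ghost edge deletes the first
edge, and a vertex changes nothing, unless the result is zero. So a generator shifts lengths by its
degree. -/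
theorem length_eq_of_genOp_ne_zero [DecidableEq (Σ a, PathTo v a)] (g : Gen E)
    (x y : Σ a, PathTo v a)
    (h : genOp k v g (Pi.single y 1) x ≠ 0) : (x.2.length : ℤ) = g.deg + y.2.length := by
  classical
  obtain ⟨a, p⟩ := x
  cases g with
  | vertex u =>
    rw [genOp, vertexOp_apply] at h
    have h := (ite_ne_right_iff.1 h).2
    rw [Pi.single_apply] at h
    obtain rfl := (ite_ne_right_iff.1 h).1
    simp [Gen.deg]
  | edge e =>
    rw [genOp] at h
    cases p with
    | nil => exact (h (edgeOp_nil _ _)).elim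
    | cons e' p =>
      rw [edgeOp_cons] at h
      have h := (ite_ne_right_iff.1 h).2
      rw [Pi.single_apply] at h
      obtain rfl := (ite_ne_right_iff.1 h).1
      simp [Gen.deg, PathTo.length, add_comm]
  | ghost e =>
    rw [genOp] at h
    by_cases ha : a = e.right
    · subst ha
      rw [ghostOp_self, Pi.single_apply] at h
      obtain rfl := (ite_ne_right_iff.1 h).1
      simp [Gen.deg, PathTo.length]
    · exact (h (ghostOp_of_ne _ _ _ ha)).elim

end Operators

variable [Fintype E] [∀ a b : E, Fintype (a ⟶ b)] {v : E}

/-- Deleting an edge undoes prepending it, which is the relation e*f = δ r(e). The relation for the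
sum of the e e* holds because a nontrivial path has exactly one first edge; trivial paths cause no
defect because `v` is a sink. -/
theorem lift_genOp_rel (hv : IsSink v) {x y : FreeAlgebra k (Gen E)} (h : Rel k E x y) :
    FreeAlgebra.lift k (genOp k v) x = FreeAlgebra.lift k (genOp k v) y := by
  classical
  cases h with
  | vertex_mul_self u =>
    simp only [map_mul, FreeAlgebra.lift_ι_apply, genOp]
    refine LinearMap.ext fun f => funext fun ⟨a, p⟩ => ?_
    simp +contextual [Module.End.mul_apply, vertexOp_apply]
  | vertex_mul_of_ne u w h =>
    simp only [map_mul, FreeAlgebra.lift_ι_apply, genOp, map_zero]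
    refine LinearMap.ext fun f => funext fun ⟨a, p⟩ => ?_
    simp only [Module.End.mul_apply, vertexOp_apply]
    split_ifs with h₁ h₂
    · exact (h (h₁.symm.trans h₂)).elim
    · rfl
    · rfl
  | source_mul_edge e =>
    simp only [map_mul, FreeAlgebra.lift_ι_apply, genOp]
    refine LinearMap.ext fun f => funext fun ⟨a, p⟩ => ?_
    rw [Module.End.mul_apply, vertexOp_apply]
    cases p with
    | nil => rw [edgeOp_nil, ite_self]
    | cons e' p =>
      rw [edgeOp_cons]
      split_ifs with h₁ h₂ h₂
      · rfl
      · rfl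
      · subst h₂; exact (h₁ rfl).elim
      · rfl
  | edge_mul_range e =>
    simp only [map_mul, FreeAlgebra.lift_ι_apply, genOp]
    refine LinearMap.ext fun f => funext fun ⟨a, p⟩ => ?_
    rw [Module.End.mul_apply]
    cases p with
    | nil => rfl
    | cons e' p =>
      rw [edgeOp_cons, edgeOp_cons, vertexOp_apply]
      split_ifs with h₁ h₂
      · rfl
      · subst h₁; exact (h₂ rfl).elim
      · rfl
  | range_mul_ghost e =>
    simp only [map_mul, FreeAlgebra.lift_ι_apply, genOp]
    refine LinearMap.ext fun f => funext fun ⟨a, p⟩ => ?_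
    rw [Module.End.mul_apply, vertexOp_apply]
    split_ifs with h
    · rfl
    · rw [ghostOp_of_ne _ _ _ h]
  | ghost_mul_source e =>
    simp only [map_mul, FreeAlgebra.lift_ι_apply, genOp]
    refine LinearMap.ext fun f => funext fun ⟨a, p⟩ => ?_
    rw [Module.End.mul_apply]
    by_cases h : a = e.right
    · subst h
      rw [ghostOp_self, ghostOp_self, vertexOp_apply, if_pos rfl]
    · rw [ghostOp_of_ne _ _ _ h, ghostOp_of_ne _ _ _ h]
  | ck1_self e =>
    simp only [map_mul, FreeAlgebra.lift_ι_apply, genOp]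
    refine LinearMap.ext fun f => funext fun ⟨a, p⟩ => ?_
    rw [Module.End.mul_apply, vertexOp_apply]
    by_cases h : a = e.right
    · subst h
      rw [ghostOp_self, edgeOp_cons, if_pos rfl, if_pos rfl]
    · rw [ghostOp_of_ne _ _ _ h, if_neg h]
  | ck1_of_ne e e' h' =>
    simp only [map_mul, FreeAlgebra.lift_ι_apply, genOp, map_zero]
    refine LinearMap.ext fun f => funext fun ⟨a, p⟩ => ?_
    rw [Module.End.mul_apply]
    by_cases h : a = e.right
    · subst h
      rw [ghostOp_self, edgeOp_cons, if_neg h']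
      rfl
    · rw [ghostOp_of_ne _ _ _ h]
      rfl
  | ck2 u hu =>
    simp only [map_mul, map_sum, FreeAlgebra.lift_ι_apply, genOp]
    refine LinearMap.ext fun f => funext fun ⟨a, p⟩ => ?_
    simp only [LinearMap.sum_apply, Finset.sum_apply, Module.End.mul_apply, vertexOp_apply]
    cases p with
    | nil =>
      obtain ⟨w, ⟨e⟩⟩ := hu
      -- The vertex `u` emits an edge, so it is not the sink at which the trivial path starts.
      rw [if_neg (by rintro rfl; exact (hv w).false e)]
      simp [edgeOp_nil]
    | @cons _ b e' p =>
      simp only [edgeOp_cons]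
      split_ifs with h
      · subst h
        rw [Finset.sum_eq_single b, Finset.sum_eq_single e', if_pos rfl]
        · exact ghostOp_self ⟨a, b, e'⟩ f p
        · intro e _ he
          rw [if_neg]
          intro h
          injection h with _ _ h
          exact he h.symm
        · simp
        · intro w _ hw
          refine Finset.sum_eq_zero fun e _ => if_neg ?_
          intro h
          injection h with _ h
          exact hw h.symm
        · simp
      · refine Finset.sum_eq_zero fun w _ => Finset.sum_eq_zero fun e _ => if_neg ?_
        intro h'
        injection h' with h'
        exact h h'
  | sum_vertex =>
    simp only [map_sum, FreeAlgebra.lift_ι_apply, genOp, map_one]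
    refine LinearMap.ext fun f => funext fun ⟨a, p⟩ => ?_
    simp [vertexOp_apply]

/-- The representation of `L_k(E)` on functions on the paths ending at the sink `v`. -/
noncomputable def pathRep (hv : IsSink v) :
    LeavittPathAlgebra k E →ₐ[k] Module.End k ((Σ a, PathTo v a) → k) :=
  RingQuot.liftAlgHom k ⟨FreeAlgebra.lift k (genOp k v), fun _ _ h => lift_genOp_rel k hv h⟩

theorem pathRep_mkGen (hv : IsSink v) (x : Gen E) :
    pathRep k hv (mkGen k E x) = genOp k v x := by
  simp [pathRep, mkGen]

/-- A path, as an element of `L_k(E)`. -/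
def realPath : {a : E} → PathTo v a → LeavittPathAlgebra k E
  | _, .nil => mkGen k E (.vertex v)
  | _, .cons e p => mkGen k E (.edge ⟨_, _, e⟩) * realPath p

/-- A ghost path, as an element of `L_k(E)`. -/
def ghostPath : {a : E} → PathTo v a → LeavittPathAlgebra k E
  | _, .nil => mkGen k E (.vertex v)
  | _, .cons e p => ghostPath p * mkGen k E (.ghost ⟨_, _, e⟩)

/-! ### Multiplication of the elements p q* -/

section Relations

variable {k}

theorem mkGen_vertex_mul_self (u : E) :
    mkGen k E (.vertex u) * mkGen k E (.vertex u) = mkGen k E (.vertex u) := by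
  simpa [mkGen] using RingQuot.mkAlgHom_rel k (Rel.vertex_mul_self (k := k) u)

theorem mkGen_vertex_mul_of_ne {u w : E} (h : u ≠ w) :
    mkGen k E (.vertex u) * mkGen k E (.vertex w) = 0 := by
  simpa [mkGen] using RingQuot.mkAlgHom_rel k (Rel.vertex_mul_of_ne (k := k) u w h)

theorem mkGen_source_mul_edge (e : Quiver.Total E) :
    mkGen k E (.vertex e.left) * mkGen k E (.edge e) = mkGen k E (.edge e) := by
  simpa [mkGen] using RingQuot.mkAlgHom_rel k (Rel.source_mul_edge (k := k) e)

theorem mkGen_edge_mul_range (e : Quiver.Total E) :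
    mkGen k E (.edge e) * mkGen k E (.vertex e.right) = mkGen k E (.edge e) := by
  simpa [mkGen] using RingQuot.mkAlgHom_rel k (Rel.edge_mul_range (k := k) e)

theorem mkGen_range_mul_ghost (e : Quiver.Total E) :
    mkGen k E (.vertex e.right) * mkGen k E (.ghost e) = mkGen k E (.ghost e) := by
  simpa [mkGen] using RingQuot.mkAlgHom_rel k (Rel.range_mul_ghost (k := k) e)

theorem mkGen_ghost_mul_source (e : Quiver.Total E) :
    mkGen k E (.ghost e) * mkGen k E (.vertex e.left) = mkGen k E (.ghost e) := by
  simpa [mkGen] using RingQuot.mkAlgHom_rel k (Rel.ghost_mul_source (k := k) e)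

theorem mkGen_ck1_self (e : Quiver.Total E) :
    mkGen k E (.ghost e) * mkGen k E (.edge e) = mkGen k E (.vertex e.right) := by
  simpa [mkGen] using RingQuot.mkAlgHom_rel k (Rel.ck1_self (k := k) e)

theorem mkGen_ck1_of_ne {e f : Quiver.Total E} (h : e ≠ f) :
    mkGen k E (.ghost e) * mkGen k E (.edge f) = 0 := by
  simpa [mkGen] using RingQuot.mkAlgHom_rel k (Rel.ck1_of_ne (k := k) e f h)

theorem mkGen_ck2 {u : E} (h : ∃ w : E, Nonempty (u ⟶ w)) :
    ∑ w : E, ∑ e : u ⟶ w, mkGen k E (.edge ⟨u, w, e⟩) * mkGen k E (.ghost ⟨u, w, e⟩) =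
      mkGen k E (.vertex u) := by
  simpa [mkGen] using RingQuot.mkAlgHom_rel k (Rel.ck2 (k := k) u h)

theorem sum_mkGen_vertex : ∑ u : E, mkGen k E (.vertex u) = 1 := by
  simpa [mkGen] using RingQuot.mkAlgHom_rel k (Rel.sum_vertex (k := k) (E := E))

theorem vertex_mul_realPath {a : E} (p : PathTo v a) :
    mkGen k E (.vertex a) * realPath k p = realPath k p := by
  cases p with
  | nil => exact mkGen_vertex_mul_self v
  | cons e p => rw [realPath, ← mul_assoc, mkGen_source_mul_edge ⟨_, _, e⟩]

theorem vertex_mul_realPath_of_ne {u a : E} (h : u ≠ a) (p : PathTo v a) :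
    mkGen k E (.vertex u) * realPath k p = 0 := by
  rw [← vertex_mul_realPath, ← mul_assoc, mkGen_vertex_mul_of_ne h, zero_mul]

theorem ghostPath_mul_vertex {a : E} (p : PathTo v a) :
    ghostPath k p * mkGen k E (.vertex a) = ghostPath k p := by
  cases p with
  | nil => exact mkGen_vertex_mul_self v
  | cons e p => rw [ghostPath, mul_assoc, mkGen_ghost_mul_source ⟨_, _, e⟩]

theorem edge_mul_realPath_of_ne {e : Quiver.Total E} {a : E} (h : e.right ≠ a) (p : PathTo v a) :
    mkGen k E (.edge e) * realPath k p = 0 := by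
  rw [← mkGen_edge_mul_range, mul_assoc, vertex_mul_realPath_of_ne h, mul_zero]

theorem ghostPath_mul_ghost_of_ne {e : Quiver.Total E} {a : E} (h : a ≠ e.right)
    (p : PathTo v a) : ghostPath k p * mkGen k E (.ghost e) = 0 := by
  rw [← mkGen_range_mul_ghost, ← ghostPath_mul_vertex, mul_assoc, ← mul_assoc (mkGen k E _),
    mkGen_vertex_mul_of_ne h, zero_mul, mul_zero]

theorem realPath_mem {a : E} (p : PathTo v a) : realPath k p ∈ grading k E p.length := by
  induction p with
  | nil => exact mkGen_mem (Gen.vertex v)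
  | cons e p ih =>
    have := SetLike.GradedMul.mul_mem (A := grading k E) (mkGen_mem (.edge ⟨_, _, e⟩)) ih
    rwa [show (Gen.edge ⟨_, _, e⟩ : Gen E).deg + (p.length : ℤ) =
      ((PathTo.cons e p).length : ℕ) by simp [Gen.deg, PathTo.length, add_comm]] at this

theorem ghostPath_mem {a : E} (p : PathTo v a) : ghostPath k p ∈ grading k E (-p.length) := by
  induction p with
  | nil => exact mkGen_mem (Gen.vertex v)
  | cons e p ih =>
    have := SetLike.GradedMul.mul_mem (A := grading k E) ih (mkGen_mem (.ghost ⟨_, _, e⟩))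
    rwa [show -(p.length : ℤ) + (Gen.ghost ⟨_, _, e⟩ : Gen E).deg =
      -((PathTo.cons e p).length : ℕ) by simp [Gen.deg, PathTo.length, add_comm]] at this

variable (k) in
/-- The product `p q*`. -/
def unit (x y : Σ a, PathTo v a) : LeavittPathAlgebra k E :=
  realPath k x.2 * ghostPath k y.2

theorem unit_mem (x y : Σ a, PathTo v a) :
    unit k x y ∈ grading k E (x.2.length - y.2.length) :=
  SetLike.GradedMul.mul_mem (A := grading k E) (realPath_mem x.2) (ghostPath_mem y.2)

/-- Left multiplication by a generator lengthens p, shortens it, fixes it or kills the product, and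
q* is untouched. This makes the span of the p q* a left ideal. -/
theorem mkGen_mul_unit_mem (hv : IsSink v) (g : Gen E) (x y : Σ a, PathTo v a) :
    mkGen k E g * unit k x y ∈ Submodule.span k (Set.range fun z : _ × _ =>
      unit k (v := v) z.1 z.2) := by
  obtain ⟨a, p⟩ := x
  have hmem (x) : unit k x y ∈ Submodule.span k (Set.range fun z : _ × _ =>
    unit k (v := v) z.1 z.2) := Submodule.subset_span ⟨(x, y), rfl⟩
  rw [unit, ← mul_assoc]
  cases g with
  | vertex u =>
    by_cases h : u = a
    · subst h
      rw [vertex_mul_realPath]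
      exact hmem ⟨u, p⟩
    · rw [vertex_mul_realPath_of_ne h, zero_mul]
      exact zero_mem _
  | edge e =>
    by_cases h : e.right = a
    · subst h
      exact hmem ⟨e.left, .cons e.hom p⟩
    · rw [edge_mul_realPath_of_ne h, zero_mul]
      exact zero_mem _
  | ghost e =>
    cases p with
    | nil =>
      -- Here e* v = e* s(e) v vanishes, since the sink `v` is not the source of `e`.
      rw [realPath, ← mkGen_ghost_mul_source, mul_assoc (mkGen k E (.ghost e)),
        mkGen_vertex_mul_of_ne, mul_zero, zero_mul]
      · exact zero_mem _
      · rintro rfl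
        exact (hv _).false e.hom
    | @cons _ b e' p =>
      rw [realPath, ← mul_assoc]
      by_cases h : e = ⟨a, b, e'⟩
      · subst h
        rw [mkGen_ck1_self, vertex_mul_realPath]
        exact hmem ⟨b, p⟩
      · rw [mkGen_ck1_of_ne h, zero_mul, zero_mul]
        exact zero_mem _

/-- Induction from ranges to sources: a = ∑ e r(e) e*, and a term p q* in the expansion of r(e)
becomes (ep)(eq)*. The induction starts at the only sink, where v = v v*. -/
theorem vertex_mem_span_unit (hE : IsAcyclicGraph E) (hv : ∀ x : E, IsSink x ↔ x = v) (a : E) :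
    mkGen k E (.vertex a) ∈ Submodule.span k (Set.range fun z : _ × _ =>
      unit k (v := v) z.1 z.2) := by
  induction a using hE.wellFounded.induction with
  | _ a ih =>
    by_cases h : ∃ w : E, Nonempty (a ⟶ w)
    · rw [← mkGen_ck2 h]
      refine sum_mem fun w _ => sum_mem fun e _ => ?_
      rw [← mkGen_edge_mul_range]
      have := ih w ⟨e⟩
      change mkGen k E _ * mkGen k E (.vertex w) * _ ∈ _
      -- Only membership in the span matters from here on, so the vertex between e and e* can be
      -- replaced by an arbitrary element of it and the induction on spans applied.
      generalize mkGen k E (.vertex w) = x at this ⊢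
      induction this using Submodule.span_induction with
      | mem x hx =>
        obtain ⟨⟨⟨b, p⟩, ⟨c, q⟩⟩, rfl⟩ := hx
        dsimp only [unit]
        by_cases hb : w = b
        · by_cases hc : c = w
          · subst hb hc
            refine Submodule.subset_span ⟨(⟨a, .cons e p⟩, ⟨a, .cons e q⟩), ?_⟩
            simp only [realPath, ghostPath, mul_assoc]
          · rw [mul_assoc, mul_assoc, ghostPath_mul_ghost_of_ne (e := ⟨a, w, e⟩) hc, mul_zero,
              mul_zero]
            exact zero_mem _
        · rw [← mul_assoc, edge_mul_realPath_of_ne (e := ⟨a, w, e⟩) hb, zero_mul, zero_mul]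
          exact zero_mem _
      | zero => simp
      | add x y _ _ hx hy => rw [mul_add, add_mul]; exact add_mem hx hy
      | smul c x _ hx =>
        rw [mul_smul_comm, smul_mul_assoc]
        exact Submodule.smul_mem _ c hx
    · have : a = v := (hv a).1 fun w => ⟨fun e => h ⟨w, ⟨e⟩⟩⟩
      subst this
      exact Submodule.subset_span ⟨(⟨a, .nil⟩, ⟨a, .nil⟩), mkGen_vertex_mul_self a⟩

/-- The span is a left ideal that contains 1, the sum of the vertices. -/
theorem span_unit (hE : IsAcyclicGraph E) (hv : ∀ x : E, IsSink x ↔ x = v) :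
    Submodule.span k (Set.range fun z : _ × _ => unit k (v := v) z.1 z.2) = ⊤ := by
  refine Submodule.eq_top_iff'.2 fun x => ?_
  obtain ⟨x, rfl⟩ := RingQuot.mkAlgHom_surjective k (Rel k E) x
  set S := Submodule.span k (Set.range fun z : _ × _ => unit k (v := v) z.1 z.2)
  suffices h : ∀ s ∈ S, RingQuot.mkAlgHom k (Rel k E) x * s ∈ S by
    have := h 1 (by
      rw [← sum_mkGen_vertex]
      exact sum_mem fun a _ => vertex_mem_span_unit hE hv a)
    rwa [mul_one] at this
  induction x using FreeAlgebra.induction with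
  | grade0 c =>
    intro s hs
    rw [AlgHom.commutes, ← Algebra.smul_def]
    exact S.smul_mem c hs
  | grade1 g =>
    intro s hs
    change mkGen k E g * s ∈ S
    induction hs using Submodule.span_induction with
    | mem x hx =>
      obtain ⟨z, rfl⟩ := hx
      exact mkGen_mul_unit_mem ((hv v).2 rfl) g _ _
    | zero => rw [mul_zero]; exact zero_mem _
    | add x y _ _ hx hy => rw [mul_add]; exact add_mem hx hy
    | smul c x _ hx => rw [mul_smul_comm]; exact S.smul_mem c hx
  | mul x y hx hy => intro s hs; rw [map_mul, mul_assoc]; exact hx _ (hy _ hs)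
  | add x y hx hy => intro s hs; rw [map_add, add_mul]; exact add_mem (hx _ hs) (hy _ hs)

-- A path p acts as the rank-one operator f ↦ f(trivial path) δ_p.
open Classical in
theorem pathRep_realPath (hv : IsSink v) {a : E} (p : PathTo v a) (f : (Σ a, PathTo v a) → k)
    (x : Σ a, PathTo v a) :
    pathRep k hv (realPath k p) f x = if x = ⟨a, p⟩ then f ⟨v, .nil⟩ else 0 := by
  induction p generalizing x with
  | nil =>
    obtain ⟨b, q⟩ := x
    rw [realPath, pathRep_mkGen, genOp, vertexOp_apply]
    by_cases h : b = v
    · subst h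
      rw [q.eq_nil_of_isSink hv, if_pos rfl, if_pos rfl]
    · rw [if_neg h, if_neg]
      rintro ⟨⟩
      exact h rfl
  | @cons a c e p ih =>
    obtain ⟨b, q⟩ := x
    rw [realPath, map_mul, Module.End.mul_apply, pathRep_mkGen, genOp]
    cases q with
    | nil => rw [edgeOp_nil, if_neg (by rintro ⟨⟩)]
    | cons e' q =>
      rw [edgeOp_cons, ih]
      by_cases h : (⟨b, _, e'⟩ : Quiver.Total E) = ⟨a, c, e⟩
      · cases h
        rw [if_pos rfl]
        congr 1
        simp
      · rw [if_neg h, if_neg]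
        rintro ⟨⟩
        exact h rfl

-- A ghost path p* acts as f ↦ f(p) δ on the trivial path: the only path starting at the sink `v` is
-- the trivial one. Combined with `pathRep_realPath`, p q* acts as a matrix unit.
open Classical in
theorem pathRep_ghostPath (hv : IsSink v) {a : E} (p : PathTo v a) (f : (Σ a, PathTo v a) → k)
    (x : Σ a, PathTo v a) :
    pathRep k hv (ghostPath k p) f x = if x.1 = v then f ⟨a, p⟩ else 0 := by
  induction p generalizing f with
  | nil =>
    obtain ⟨b, q⟩ := x
    rw [ghostPath, pathRep_mkGen, genOp, vertexOp_apply]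
    by_cases h : b = v
    · subst h
      rw [q.eq_nil_of_isSink hv]
    · rw [if_neg h, if_neg h]
  | @cons a c e p ih =>
    rw [ghostPath, map_mul, Module.End.mul_apply, ih, pathRep_mkGen, genOp]
    exact congrArg (fun y => if x.1 = v then y else 0) (ghostOp_self ⟨a, c, e⟩ f p)

end Relations

/-! ## Leavitt path algebras as graded matrix algebras -/

section Matrix

variable [Fintype (Σ a, PathTo v a)] [DecidableEq (Σ a, PathTo v a)]

/-- The matrix of the representation on the paths ending at the sink `v`. -/
noncomputable def pathMatrix (hv : IsSink v) :
    LeavittPathAlgebra k E →ₐ[k] Matrix (Σ a, PathTo v a) (Σ a, PathTo v a) k :=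
  LinearMap.toMatrixAlgEquiv'.toAlgHom.comp (pathRep k hv)

variable {k}

theorem pathMatrix_apply (hv : IsSink v) (a : LeavittPathAlgebra k E) (x y : Σ a, PathTo v a) :
    pathMatrix k hv a x y = pathRep k hv a (Pi.single y 1) x := by
  simp [pathMatrix, LinearMap.toMatrixAlgEquiv'_apply, Pi.single]

theorem pathMatrix_unit (hv : IsSink v) (x y : Σ a, PathTo v a) :
    pathMatrix k hv (unit k x y) = Matrix.single x y 1 := by
  ext z t
  rw [pathMatrix_apply, unit, map_mul, Module.End.mul_apply, pathRep_realPath, pathRep_ghostPath,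
    if_pos rfl, Matrix.single_apply, Pi.single_apply]
  simp only [ite_and, eq_comm, Sigma.eta]

theorem pathMatrix_sum_unit (hv : IsSink v)
    (X : Matrix (Σ a, PathTo v a) (Σ a, PathTo v a) k) :
    pathMatrix k hv (∑ x, ∑ y, X x y • unit k x y) = X := by
  simp only [map_sum, map_smul, pathMatrix_unit, Matrix.smul_single, smul_eq_mul, mul_one]
  exact (Matrix.matrix_eq_sum_single X).symm

/-- Both sides are linear in `a`, so it suffices to check the spanning elements p q*, whose matrices
are matrix units. This yields injectivity of the matrix representation. -/
theorem sum_pathMatrix_unit (hE : IsAcyclicGraph E) (hv : ∀ x : E, IsSink x ↔ x = v)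
    (a : LeavittPathAlgebra k E) :
    ∑ x, ∑ y, pathMatrix k ((hv v).2 rfl) a x y • unit k x y = a := by
  have ha : a ∈ Submodule.span k (Set.range fun z : _ × _ => unit k (v := v) z.1 z.2) := by
    rw [span_unit hE hv]; trivial
  induction ha using Submodule.span_induction with
  | mem a h =>
    obtain ⟨⟨z, t⟩, rfl⟩ := h
    simp [pathMatrix_unit, Matrix.single_apply, ite_and]
  | zero => simp
  | add a b _ _ ha hb =>
    simp only [map_add, Matrix.add_apply, add_smul, Finset.sum_add_distrib, ha, hb]
  | smul c a _ ha =>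
    simp only [map_smul, Matrix.smul_apply, smul_assoc, ← Finset.smul_sum, ha]

variable (k) in
/-- The isomorphism of `L_k(E)` with a matrix algebra, for an acyclic graph with one sink. -/
noncomputable def pathMatrixEquiv (hE : IsAcyclicGraph E) (hv : ∀ x : E, IsSink x ↔ x = v) :
    LeavittPathAlgebra k E ≃ₐ[k] Matrix (Σ a, PathTo v a) (Σ a, PathTo v a) k :=
  AlgEquiv.ofBijective (pathMatrix k ((hv v).2 rfl))
    ⟨fun a b h => by
      rw [← sum_pathMatrix_unit hE hv a, h, sum_pathMatrix_unit hE hv b],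
    fun X => ⟨_, pathMatrix_sum_unit _ X⟩⟩

theorem length_eq_of_pathMatrix_word_ne_zero (hv : IsSink v) (l : List (Gen E))
    (x y : Σ a, PathTo v a)
    (h : pathMatrix k hv (l.map (mkGen k E)).prod x y ≠ 0) :
    (x.2.length : ℤ) = (l.map Gen.deg).sum + y.2.length := by
  induction l generalizing x with
  | nil =>
    simp only [List.map_nil, List.prod_nil, map_one, Matrix.one_apply] at h
    obtain rfl := (ite_ne_right_iff.1 h).1
    simp
  | cons g l ih =>
    rw [List.map_cons, List.prod_cons, map_mul, Matrix.mul_apply] at h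
    obtain ⟨z, -, hz⟩ := Finset.exists_ne_zero_of_sum_ne_zero h
    have h₁ := ih z (right_ne_zero_of_mul hz)
    have h₂ := left_ne_zero_of_mul hz
    rw [pathMatrix_apply, pathRep_mkGen] at h₂
    rw [length_eq_of_genOp_ne_zero g x z h₂, h₁, List.map_cons, List.sum_cons, add_assoc]

/-- A word of degree n shifts lengths by n, which gives one direction. For the other, `a` is
expanded in the p q*, which have degree |p| - |q|; the condition says that only those of degree n
occur. -/
theorem mem_grading_iff (hE : IsAcyclicGraph E) (hv : ∀ x : E, IsSink x ↔ x = v) (n : ℤ)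
    (a : LeavittPathAlgebra k E) :
    a ∈ grading k E n ↔ ∀ x y : Σ a, PathTo v a, pathMatrixEquiv k hE hv a x y ≠ 0 →
      (x.2.length : ℤ) = n + y.2.length := by
  change _ ↔ ∀ x y : Σ a, PathTo v a, pathMatrix k ((hv v).2 rfl) a x y ≠ 0 → _
  constructor
  · intro ha
    induction ha using Submodule.span_induction with
    | mem a h =>
      obtain ⟨l, rfl, rfl⟩ := h
      exact length_eq_of_pathMatrix_word_ne_zero _ l
    | zero => intro x y h; simp at h
    | add a b _ _ ha hb =>
      intro x y h
      rw [map_add, Matrix.add_apply] at h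
      by_cases hx : pathMatrix k ((hv v).2 rfl) a x y = 0
      · rw [hx, zero_add] at h
        exact hb x y h
      · exact ha x y hx
    | smul c a _ ha =>
      intro x y h
      rw [map_smul, Matrix.smul_apply] at h
      exact ha x y (right_ne_zero_of_smul h)
  · intro h
    rw [← sum_pathMatrix_unit hE hv a]
    refine sum_mem fun x _ => sum_mem fun y _ => ?_
    by_cases hxy : pathMatrix k ((hv v).2 rfl) a x y = 0
    · rw [hxy, zero_smul]
      exact zero_mem _
    · refine Submodule.smul_mem _ _ ?_
      have := unit_mem (k := k) x y
      rwa [h x y hxy, add_sub_cancel_right] at this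

end Matrix

end LeavittPathAlgebra

/-! ## Corners of matrix rings -/

section Corner

open MulOpposite

variable {R S : Type u} [Ring R] [Ring S] {P Q : Type u} [Fintype P] [Fintype Q]

section RowMul

variable {M : Type*} [AddCommGroup M] [Module Rᵐᵒᵖ M]

/-- The product of a row with entries in a right module and a matrix. -/
def rowMul (x : Q → M) (X : Matrix Q Q R) : Q → M :=
  fun q' => ∑ q, op (X q q') • x q

theorem rowMul_mul (x : Q → M) (X Y : Matrix Q Q R) :
    rowMul x (X * Y) = rowMul (rowMul x X) Y := by
  funext q'
  simp only [rowMul, Matrix.mul_apply, Finset.op_sum, op_mul, Finset.sum_smul, mul_smul,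
    Finset.smul_sum]
  exact Finset.sum_comm

theorem rowMul_add (x : Q → M) (X Y : Matrix Q Q R) :
    rowMul x (X + Y) = rowMul x X + rowMul x Y := by
  funext q'
  simp [rowMul, add_smul, Finset.sum_add_distrib]

theorem add_rowMul (x y : Q → M) (X : Matrix Q Q R) :
    rowMul (x + y) X = rowMul x X + rowMul y X := by
  funext q'
  simp [rowMul, Finset.sum_add_distrib]

theorem rowMul_zero (x : Q → M) : rowMul x (0 : Matrix Q Q R) = 0 := by
  funext q'
  simp [rowMul]

theorem zero_rowMul (X : Matrix Q Q R) : rowMul (0 : Q → M) X = 0 := by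
  funext q'
  simp [rowMul]

theorem neg_rowMul (x : Q → M) (X : Matrix Q Q R) : rowMul (-x) X = -rowMul x X := by
  funext q'
  simp [rowMul]

theorem map_rowMul {N : Type*} [AddCommGroup N] [Module Rᵐᵒᵖ N] (f : M →ₗ[Rᵐᵒᵖ] N) (x : Q → M)
    (X : Matrix Q Q R) : rowMul (fun q => f (x q)) X = fun q => f (rowMul x X q) := by
  funext q'
  simp [rowMul]

end RowMul

variable (Φ : S →ₙ+* Matrix Q Q R)

/-- The rows with entries in `M` that are fixed by the idempotent matrix `Φ 1`. -/
def corner (M : Type*) [AddCommGroup M] [Module Rᵐᵒᵖ M] : AddSubgroup (Q → M) where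
  carrier := {x | rowMul x (Φ 1) = x}
  add_mem' := fun {x y} hx hy => by
    change rowMul _ _ = _ at *
    rw [add_rowMul, hx, hy]
  zero_mem' := zero_rowMul _
  neg_mem' := fun {x} hx => by
    change rowMul _ _ = _ at *
    rw [neg_rowMul, hx]

section

variable {Φ} {M : Type*} [AddCommGroup M] [Module Rᵐᵒᵖ M]

theorem mem_corner {x : Q → M} : x ∈ corner Φ M ↔ rowMul x (Φ 1) = x := Iff.rfl

theorem rowMul_mem_corner (x : Q → M) (s : S) : rowMul x (Φ s) ∈ corner Φ M := by
  rw [mem_corner, ← rowMul_mul, ← map_mul, mul_one]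

/-- The action of `S` on a corner through `Φ`. -/
instance : Module Sᵐᵒᵖ (corner Φ M) where
  smul s x := ⟨rowMul x.1 (Φ s.unop), rowMul_mem_corner _ _⟩
  one_smul x := Subtype.ext x.2
  mul_smul s t x := Subtype.ext (by
    change rowMul x.1 (Φ (t.unop * s.unop)) = rowMul (rowMul x.1 _) _
    rw [map_mul, rowMul_mul])
  smul_zero s := Subtype.ext (zero_rowMul _)
  smul_add s x y := Subtype.ext (add_rowMul _ _ _)
  add_smul s t x := Subtype.ext (by
    change rowMul x.1 (Φ (s.unop + t.unop)) = rowMul x.1 _ + rowMul x.1 _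
    rw [map_add, rowMul_add])
  zero_smul x := Subtype.ext (by
    change rowMul x.1 (Φ 0) = 0
    rw [map_zero, rowMul_zero])

theorem corner_smul_apply (s : S) (x : corner Φ M) (q' : Q) :
    (op s • x).1 q' = ∑ q, op (Φ s q q') • x.1 q := rfl

variable (Φ) in
/-- A homomorphism, applied to the entries of a row. -/
def cornerMap {N : Type*} [AddCommGroup N] [Module Rᵐᵒᵖ N] (f : M →ₗ[Rᵐᵒᵖ] N) :
    corner Φ M →ₗ[Sᵐᵒᵖ] corner Φ N where
  toFun x := ⟨fun q => f (x.1 q), by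
    rw [mem_corner, map_rowMul, mem_corner.1 x.2]⟩
  map_add' x y := Subtype.ext (funext fun _ => map_add f _ _)
  map_smul' s x := Subtype.ext (map_rowMul f x.1 _).symm

variable (Φ) in
/-- The projection of a row with a single entry to the corner. -/
def cornerSingle (q : Q) : M →+ corner Φ M where
  toFun m := ⟨fun q' => op (Φ 1 q q') • m, by
    rw [mem_corner]
    funext q'
    simp only [rowMul, ← mul_smul, ← op_mul, ← Finset.sum_smul, ← Finset.op_sum]
    rw [← Matrix.mul_apply, ← map_mul, mul_one]⟩
  map_zero' := Subtype.ext (funext fun _ => smul_zero _)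
  map_add' m n := Subtype.ext (funext fun _ => smul_add _ _ _)

theorem sum_cornerSingle (x : corner Φ M) : ∑ q, cornerSingle Φ q (x.1 q) = x := by
  refine Subtype.ext (funext fun q' => ?_)
  rw [AddSubgroup.val_finsetSum, Finset.sum_apply]
  exact congrFun (mem_corner.1 x.2) q'

end

/-- The functor `Mod-R ⥤ Mod-S` defined by corners. -/
def cornerFunctor : ModuleCat.{u} Rᵐᵒᵖ ⥤ ModuleCat.{u} Sᵐᵒᵖ where
  obj M := ModuleCat.of Sᵐᵒᵖ (corner Φ M)
  map f := ModuleCat.ofHom (cornerMap Φ f.hom)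

/-- A row `U` and a column `V` identifying `R` with the corner of a matrix ring defined by the
composite of `Ψ` and `Φ`. -/
structure CornerUnit (Φ : S →ₙ+* Matrix Q Q R) (Ψ : R →ₙ+* Matrix P P S) where
  U : P → Q → R
  V : P → Q → R
  sum_mul : ∑ p, ∑ q, U p q * V p q = 1
  mul_eq : ∀ p q p' q', V p q * U p' q' = Φ (Ψ 1 p p') q q'
  mul_row : ∀ r p' q', r * U p' q' = ∑ p, ∑ q, U p q * Φ (Ψ r p p') q q'
  col_mul : ∀ r p q, V p q * r = ∑ p', ∑ q', Φ (Ψ r p p') q q' * V p' q'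

namespace CornerUnit

variable {Φ} {Ψ : R →ₙ+* Matrix P P S} (c : CornerUnit Φ Ψ)
  {M : Type*} [AddCommGroup M] [Module Rᵐᵒᵖ M]

-- As Φ need not be unital, Φ(1) is only an idempotent. By `mul_row` with r = 1 the row is U
-- Φ(Ψ(1)), and this absorbs Φ(1) on the right, so multiples of U lie in the corner.
include c in
theorem row_mul_one (p : P) (q' : Q) : ∑ q, c.U p q * Φ 1 q q' = c.U p q' := by
  have h (q : Q) : c.U p q = ∑ p', ∑ q₁, c.U p' q₁ * Φ (Ψ 1 p' p) q₁ q := by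
    rw [← c.mul_row, one_mul]
  rw [h q', Finset.sum_congr rfl fun q _ => by rw [h q]]
  simp only [Finset.sum_mul]
  rw [Finset.sum_comm]
  refine Finset.sum_congr rfl fun p' _ => ?_
  rw [Finset.sum_comm]
  refine Finset.sum_congr rfl fun q₁ _ => ?_
  simp only [mul_assoc]
  rw [← Finset.mul_sum, ← Matrix.mul_apply, ← map_mul, mul_one]

/-- The row `m U_p`. -/
def row (p : P) : M →+ corner Φ M where
  toFun m := ⟨fun q => op (c.U p q) • m, by
    rw [mem_corner]
    funext q'
    simp only [rowMul, ← mul_smul, ← op_mul, ← Finset.sum_smul, ← Finset.op_sum]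
    rw [c.row_mul_one]⟩
  map_zero' := Subtype.ext (funext fun _ => smul_zero _)
  map_add' m n := Subtype.ext (funext fun _ => smul_add _ _ _)

theorem row_apply (p : P) (m : M) (q : Q) : (c.row p m).1 q = op (c.U p q) • m := rfl

/-- The identity r U = U Φ(Ψ(r)) makes m ↦ (m U_p)_p linear over R. -/
theorem row_smul (r : R) (m : M) (p' : P) :
    c.row p' (op r • m) = ∑ p, op (Ψ r p p') • c.row p m := by
  refine Subtype.ext (funext fun q' => ?_)
  rw [row_apply, ← mul_smul, ← op_mul, c.mul_row, AddSubgroup.val_finsetSum, Finset.sum_apply]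
  simp only [Finset.op_sum, Finset.sum_smul, corner_smul_apply, row_apply, ← mul_smul, ← op_mul]

/-- The row `m U_p`, as an element of an object of `Mod-S`. -/
def objRow (M : ModuleCat.{u} Rᵐᵒᵖ) (p : P) : M →+ (cornerFunctor Φ).obj M := c.row p

theorem objRow_smul (M : ModuleCat.{u} Rᵐᵒᵖ) (r : R) (m : M) (p' : P) :
    c.objRow M p' (op r • m) = ∑ p, op (Ψ r p p') • c.objRow M p m :=
  c.row_smul r m p'

/-- A module is the corner of its corner. -/
def linearEquiv : M ≃ₗ[Rᵐᵒᵖ] corner Ψ (corner Φ M) where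
  toFun m := ⟨fun p => c.row p m, by
    rw [mem_corner]
    funext p'
    rw [rowMul, ← row_smul, op_one, one_smul]⟩
  map_add' m n := Subtype.ext (funext fun _ => map_add _ _ _)
  map_smul' r m := Subtype.ext (funext fun p' => c.row_smul r.unop m p')
  -- Multiplication by the column V: one composite is UV = 1, the other is VU = Φ(Ψ(1)), which fixes
  -- every row in the double corner.
  invFun y := ∑ p, ∑ q, op (c.V p q) • (y.1 p).1 q
  left_inv m := by
    simp only [row_apply, ← mul_smul, ← op_mul, ← Finset.sum_smul, ← Finset.op_sum]
    rw [c.sum_mul, op_one, one_smul]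
  right_inv y := by
    refine Subtype.ext (funext fun p' => Subtype.ext (funext fun q' => ?_))
    dsimp only
    rw [row_apply]
    simp only [Finset.smul_sum, ← mul_smul, ← op_mul, c.mul_eq]
    have := congrFun (congrArg Subtype.val (congrFun (mem_corner.1 y.2) p')) q'
    rwa [rowMul, AddSubgroup.val_finsetSum, Finset.sum_apply] at this

/-- The composite of two corner functors is isomorphic to the identity. -/
def functorIso : cornerFunctor Φ ⋙ cornerFunctor Ψ ≅ 𝟭 (ModuleCat.{u} Rᵐᵒᵖ) :=
  Iso.symm <| NatIso.ofComponents (fun M => (c.linearEquiv (M := M)).toModuleIso) fun {M N} f => by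
    ext m
    refine Subtype.ext (funext fun p => Subtype.ext (funext fun q => ?_))
    exact (map_smul f.hom _ _).symm

end CornerUnit

theorem cornerFunctor_isEquivalence {Φ : S →ₙ+* Matrix Q Q R} {Ψ : R →ₙ+* Matrix P P S}
    (c : CornerUnit Φ Ψ) (c' : CornerUnit Ψ Φ) : (cornerFunctor Φ).IsEquivalence :=
  (CategoryTheory.Equivalence.mk (cornerFunctor Φ) (cornerFunctor Ψ) c.functorIso.symm
    c'.functorIso).isEquivalence_functor

end Corner

/-! ### Corners of graded modules -/

section GradedCorner

open MulOpposite

variable {Γ : Type*} [AddCommGroup Γ] [DecidableEq Γ]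
variable {A B : Type u} [Ring A] [Ring B] {σ τ : Type*} [SetLike σ A] [AddSubgroupClass σ A]
  [SetLike τ B] [AddSubgroupClass τ B]
variable {𝒜 : Γ → σ} [GradedRing 𝒜] {ℬ : Γ → τ} [GradedRing ℬ]
variable {P Q : Type u} [Fintype P] [Fintype Q]

theorem GrMod.smul_mem_of_zero (M : GrMod 𝒜) {γ : Γ} {m : M.carrier}
    (hm : m ∈ M.component γ) {a : A} (ha : a ∈ 𝒜 0) : op a • m ∈ M.component γ := by
  simpa using M.smul_mem hm ha

variable (Φ : B →ₙ+* Matrix Q Q A) (hΦ : ∀ (γ : Γ) (b : B), b ∈ ℬ γ → ∀ q q', Φ b q q' ∈ 𝒜 γ)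

/-- The homogeneous components of a corner. -/
def cornerComponent (M : GrMod 𝒜) (γ : Γ) : AddSubgroup (corner Φ M.carrier) where
  carrier := {x | ∀ q, x.1 q ∈ M.component γ}
  add_mem' hx hy q := add_mem (hx q) (hy q)
  zero_mem' _ := zero_mem _
  neg_mem' hx q := neg_mem (hx q)

-- The entries of Φ(1) have degree zero because 1 does, so projecting a row to the corner preserves
-- degrees. Each entry is decomposed and its parts are projected; they add up to x Φ(1) = x.
include hΦ in
theorem cornerComponent_isInternal (M : GrMod 𝒜) :
    DirectSum.IsInternal (cornerComponent Φ M) := by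
  let _ := M.isInternal.chooseDecomposition
  let incl (q : Q) (γ : Γ) : M.component γ →+ cornerComponent Φ M γ :=
    ((cornerSingle Φ q).comp (M.component γ).subtype).codRestrict _ fun m q' =>
      GrMod.smul_mem_of_zero M m.2 (hΦ 0 1 (SetLike.GradedOne.one_mem) q q')
  let t (q : Q) : M.carrier →+ DirectSum Γ fun γ => cornerComponent Φ M γ :=
    (DirectSum.toAddMonoid fun γ =>
      (DirectSum.of (fun γ => cornerComponent Φ M γ) γ).comp (incl q γ)).comp
      (DirectSum.decomposeAddEquiv M.component).toAddMonoidHom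
  have ht (q : Q) (γ : Γ) (m : M.carrier) (hm : m ∈ M.component γ) :
      t q m = DirectSum.of (fun γ => cornerComponent Φ M γ) γ (incl q γ ⟨m, hm⟩) := by
    change DirectSum.toAddMonoid _ (DirectSum.decompose M.component m) = _
    rw [DirectSum.decompose_of_mem _ hm, DirectSum.toAddMonoid_of]
    rfl
  have hcoe (q : Q) (m : M.carrier) :
      DirectSum.coeAddMonoidHom (cornerComponent Φ M) (t q m) = cornerSingle Φ q m := by
    induction m using DirectSum.Decomposition.inductionOn M.component with
    | zero => simp only [map_zero]
    | @homogeneous γ m => rw [ht q γ _ m.2, DirectSum.coeAddMonoidHom_of]; rfl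
    | add m n hm hn => simp only [map_add, hm, hn]
  let f : corner Φ M.carrier →+ DirectSum Γ fun γ => cornerComponent Φ M γ :=
    ∑ q, (t q).comp ((Pi.evalAddMonoidHom _ q).comp (corner Φ M.carrier).subtype)
  have hf (x : corner Φ M.carrier) : f x = ∑ q, t q (x.1 q) := by
    simp [f]
  refine (DirectSum.Decomposition.ofAddHom (cornerComponent Φ M) f ?_ ?_).isInternal
  · ext1 x
    rw [AddMonoidHom.comp_apply, hf, map_sum, Finset.sum_congr rfl fun q _ => hcoe q _]
    exact sum_cornerSingle x
  · refine DirectSum.addHom_ext fun γ x => ?_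
    rw [AddMonoidHom.comp_apply, DirectSum.coeAddMonoidHom_of, hf,
      Finset.sum_congr rfl fun q _ => ht q γ _ (x.2 q), ← map_sum]
    refine congrArg _ (Subtype.ext ?_)
    rw [AddSubgroup.val_finsetSum]
    exact sum_cornerSingle x.1

/-- The functor `Gr-A ⥤ Gr-B` defined by corners. -/
def grCornerFunctor : GrMod 𝒜 ⥤ GrMod ℬ where
  obj M :=
    { carrier := corner Φ M.carrier
      component := cornerComponent Φ M
      isInternal := cornerComponent_isInternal Φ hΦ M
      smul_mem := fun {γ δ x b} hx hb q' => by
        rw [corner_smul_apply]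
        exact sum_mem fun q _ => M.smul_mem (hx q) (hΦ δ b hb q q') }
  map f := ⟨cornerMap Φ f.toLinearMap, fun γ x hx q => f.map_mem γ _ (hx q)⟩

/-- Suspension only reindexes components and the components of a corner are taken entrywise, so the
two composites agree definitionally. -/
theorem grCornerFunctor_isGraded : IsGradedFunctor (grCornerFunctor Φ hΦ) := fun _ => rfl

/-- Isomorphisms in `Gr-A` from linear equivalences. -/
def GrMod.isoMk {M N : GrMod 𝒜} (e : M.carrier ≃ₗ[Aᵐᵒᵖ] N.carrier)
    (h : ∀ γ m, m ∈ M.component γ → e m ∈ N.component γ)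
    (h' : ∀ γ n, n ∈ N.component γ → e.symm n ∈ M.component γ) : M ≅ N where
  hom := ⟨e.toLinearMap, h⟩
  inv := ⟨e.symm.toLinearMap, h'⟩
  hom_inv_id := GrMod.Hom.ext (LinearMap.ext fun m => e.symm_apply_apply m)
  inv_hom_id := GrMod.Hom.ext (LinearMap.ext fun m => e.apply_symm_apply m)

section Unit

variable {Φ hΦ} {Ψ : A →ₙ+* Matrix P P B}
  {hΨ : ∀ (γ : Γ) (a : A), a ∈ 𝒜 γ → ∀ p p', Ψ a p p' ∈ ℬ γ}
  (c : CornerUnit Φ Ψ) (hU : ∀ p q, c.U p q ∈ 𝒜 0) (hV : ∀ p q, c.V p q ∈ 𝒜 0)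

/-- The composite of two graded corner functors is isomorphic to the identity. -/
def CornerUnit.grFunctorIso :
    grCornerFunctor Φ hΦ ⋙ grCornerFunctor Ψ hΨ ≅ 𝟭 (GrMod 𝒜) :=
  Iso.symm <| NatIso.ofComponents (fun M => GrMod.isoMk (M := M)
    (N := (grCornerFunctor Ψ hΨ).obj ((grCornerFunctor Φ hΦ).obj M)) (c.linearEquiv (M := M.carrier))
    (fun γ m hm p q => GrMod.smul_mem_of_zero M hm (hU p q))
    (fun γ y hy => by
      change c.linearEquiv.symm y ∈ M.component γ
      exact sum_mem fun p _ => sum_mem fun q _ =>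
        GrMod.smul_mem_of_zero M (hy p q) (hV p q))) fun {M N} f => by
    refine GrMod.Hom.ext (LinearMap.ext fun m => ?_)
    refine Subtype.ext (funext fun p => Subtype.ext (funext fun q => ?_))
    exact (map_smul f.toLinearMap _ _).symm

end Unit

/-! ### Restriction to degree zero -/

section Zero

/-- The restriction of a degree-preserving homomorphism to the components of degree zero. -/
def restrictZero : ℬ 0 →ₙ+* Matrix Q Q (𝒜 0) where
  toFun b := Matrix.of fun q q' => ⟨Φ b q q', hΦ 0 b b.2 q q'⟩
  map_mul' b b' := by
    ext q q'
    simp [Matrix.mul_apply]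
  map_zero' := by
    ext q q'
    simp
  map_add' b b' := by
    ext q q'
    simp

theorem coe_restrictZero (b : ℬ 0) (q q' : Q) :
    ((restrictZero Φ hΦ b q q' : 𝒜 0) : A) = Φ b q q' := rfl

variable {Φ hΦ} {Ψ : A →ₙ+* Matrix P P B}
  {hΨ : ∀ (γ : Γ) (a : A), a ∈ 𝒜 γ → ∀ p p', Ψ a p p' ∈ ℬ γ}
  (c : CornerUnit Φ Ψ) (hU : ∀ p q, c.U p q ∈ 𝒜 0) (hV : ∀ p q, c.V p q ∈ 𝒜 0)

/-- The restriction of a unit to the components of degree zero. -/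
def CornerUnit.restrictZero : CornerUnit (restrictZero Φ hΦ) (restrictZero Ψ hΨ) where
  U p q := ⟨c.U p q, hU p q⟩
  V p q := ⟨c.V p q, hV p q⟩
  sum_mul := Subtype.ext (by simpa using c.sum_mul)
  mul_eq p q p' q' := Subtype.ext (by simpa [coe_restrictZero] using c.mul_eq p q p' q')
  mul_row r p' q' := Subtype.ext (by simpa [coe_restrictZero] using c.mul_row r p' q')
  col_mul r p q := Subtype.ext (by simpa [coe_restrictZero] using c.col_mul r p q)

end Zero

end GradedCorner

/-! ## Corners of `M ⊗_{A₀} A` -/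

section CornerTensor

open MulOpposite GrMod

variable {Γ : Type*} [AddCommGroup Γ] [DecidableEq Γ]
variable {A B : Type u} [Ring A] [Ring B] {σ τ : Type*} [SetLike σ A] [AddSubgroupClass σ A]
  [SetLike τ B] [AddSubgroupClass τ B]
variable {𝒜 : Γ → σ} [GradedRing 𝒜] {ℬ : Γ → τ} [GradedRing ℬ]
variable {P Q : Type u} [Fintype P] [Fintype Q]

/-- The map `m ↦ m ⊗ a`. -/
def btmulHom (M : ModuleCat.{u} (𝒜 0)ᵐᵒᵖ) (a : A) : M →+ BalancedTensor 𝒜 M where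
  toFun m := btmul 𝒜 M m a
  map_zero' := by simp [btmul]
  map_add' m n := btmul_add_left M m n a

theorem sum_btmul {ι : Type*} (s : Finset ι) (M : ModuleCat.{u} (𝒜 0)ᵐᵒᵖ) (m : ι → M) (a : A) :
    btmul 𝒜 M (∑ i ∈ s, m i) a = ∑ i ∈ s, btmul 𝒜 M (m i) a :=
  map_sum (btmulHom M a) m s

theorem btmul_sum {ι : Type*} (s : Finset ι) (M : ModuleCat.{u} (𝒜 0)ᵐᵒᵖ) (m : M) (a : ι → A) :
    btmul 𝒜 M m (∑ i ∈ s, a i) = ∑ i ∈ s, btmul 𝒜 M m (a i) :=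
  map_sum (AddMonoidHom.mk' (btmul 𝒜 M m) (btmul_add M m)) a s

variable (Φ : B →ₙ+* Matrix Q Q A) (hΦ : ∀ (γ : Γ) (b : B), b ∈ ℬ γ → ∀ q q', Φ b q q' ∈ 𝒜 γ)
variable (M : ModuleCat.{u} (𝒜 0)ᵐᵒᵖ)

/-- The map `(b, x) ↦ (∑ q, x_q ⊗ Φ(b)_{q q'})_{q'}`. -/
def cornerTensorPre : B →+ (cornerFunctor (restrictZero Φ hΦ)).obj M →+
    corner Φ (BalancedTensor 𝒜 M) :=
  AddMonoidHom.mk' (fun b => AddMonoidHom.mk'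
    (fun x => ⟨fun q' => ∑ q, btmul 𝒜 M (x.1 q) (Φ b q q'), by
      rw [mem_corner]
      funext q'
      simp only [rowMul, Finset.smul_sum, op_smul_btmul]
      rw [Finset.sum_comm]
      refine Finset.sum_congr rfl fun q _ => ?_
      rw [← btmul_sum, ← Matrix.mul_apply, ← map_mul, mul_one]⟩)
    fun x y => Subtype.ext (funext fun q' => by
      refine Eq.trans ?_ Finset.sum_add_distrib
      exact Finset.sum_congr rfl fun q _ => btmul_add_left M _ _ _))
    fun b b' => AddMonoidHom.ext fun x => Subtype.ext (funext fun q' => by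
      refine Eq.trans ?_ Finset.sum_add_distrib
      refine Finset.sum_congr rfl fun q _ => ?_
      rw [map_add]
      exact btmul_add M _ _ _)

theorem cornerTensorPre_apply (b : B) (x : (cornerFunctor (restrictZero Φ hΦ)).obj M) (q' : Q) :
    (cornerTensorPre Φ hΦ M b x).1 q' = ∑ q, btmul 𝒜 M (x.1 q) (Φ b q q') := rfl

/-- The canonical map from the tensor product of the corner to the corner of the tensor product. -/
def cornerTensor : BalancedTensor ℬ ((cornerFunctor (restrictZero Φ hΦ)).obj M) →+
    corner Φ (BalancedTensor 𝒜 M) :=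
  btLift _ (cornerTensorPre Φ hΦ M) fun r b x => Subtype.ext (funext fun q' => by
    rw [cornerTensorPre_apply, cornerTensorPre_apply]
    simp only [map_mul, Matrix.mul_apply, btmul_sum]
    rw [Finset.sum_comm]
    refine Finset.sum_congr rfl fun q _ => ?_
    refine Eq.trans ?_ (sum_btmul _ M _ _).symm
    refine Finset.sum_congr rfl fun q₁ _ => ?_
    exact btmul_balanced M (restrictZero Φ hΦ r q₁ q) (x.1 q₁) (Φ b q q'))

theorem cornerTensor_btmul (x : (cornerFunctor (restrictZero Φ hΦ)).obj M) (b : B) :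
    cornerTensor Φ hΦ M (btmul ℬ _ x b) = cornerTensorPre Φ hΦ M b x := rfl

theorem cornerTensor_smul (b : B)
    (y : BalancedTensor ℬ ((cornerFunctor (restrictZero Φ hΦ)).obj M)) :
    cornerTensor Φ hΦ M (op b • y) = op b • cornerTensor Φ hΦ M y := by
  refine DFunLike.congr_fun (f := (cornerTensor Φ hΦ M).comp (DistribSMul.toAddMonoidHom _ (op b)))
    (g := (DistribSMul.toAddMonoidHom _ (op b)).comp (cornerTensor Φ hΦ M))
    (bt_addHom_ext _ fun x a => ?_) y
  change cornerTensor Φ hΦ M (op b • btmul ℬ _ x a) = op b • cornerTensor Φ hΦ M (btmul ℬ _ x a)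
  rw [op_smul_btmul, cornerTensor_btmul, cornerTensor_btmul]
  refine Subtype.ext (funext fun q' => ?_)
  rw [cornerTensorPre_apply, corner_smul_apply]
  simp only [cornerTensorPre_apply, Finset.smul_sum, op_smul_btmul, map_mul, Matrix.mul_apply,
    btmul_sum]
  exact Finset.sum_comm

variable {Φ hΦ} {Ψ : A →ₙ+* Matrix P P B}
  {hΨ : ∀ (γ : Γ) (a : A), a ∈ 𝒜 γ → ∀ p p', Ψ a p p' ∈ ℬ γ}
  (c : CornerUnit (restrictZero Φ hΦ) (restrictZero Ψ hΨ)) (V : Q → P → B)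

/-- The map `(a, m) ↦ ∑ p, m U_p ⊗ (Ψ(a) V)_p`. -/
def cornerTensorInvPre (q : Q) : A →+ M →+
    BalancedTensor ℬ ((cornerFunctor (restrictZero Φ hΦ)).obj M) :=
  AddMonoidHom.mk' (fun a => ∑ p, ∑ p', (btmulHom _ (Ψ a p p' * V q p')).comp (c.objRow M p))
    fun a a' => AddMonoidHom.ext fun m => by
      simp only [AddMonoidHom.finsetSum_apply, AddMonoidHom.add_apply, ← Finset.sum_add_distrib]
      refine Finset.sum_congr rfl fun p _ => Finset.sum_congr rfl fun p' _ => ?_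
      rw [map_add, Matrix.add_apply, add_mul]
      exact btmul_add _ _ _ _

theorem cornerTensorInvPre_apply (q : Q) (a : A) (m : M) :
    cornerTensorInvPre M c V q a m =
      ∑ p, ∑ p', btmul ℬ _ (c.objRow M p m) (Ψ a p p' * V q p') := by
  simp only [cornerTensorInvPre, AddMonoidHom.mk'_apply, AddMonoidHom.finsetSum_apply]
  rfl

/-- The inverse of `cornerTensor` on rows with a single entry. -/
def cornerTensorInv (q : Q) : BalancedTensor 𝒜 M →+
    BalancedTensor ℬ ((cornerFunctor (restrictZero Φ hΦ)).obj M) :=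
  btLift _ (cornerTensorInvPre M c V q) fun r a m => by
    rw [cornerTensorInvPre_apply, cornerTensorInvPre_apply]
    simp only [map_mul, Matrix.mul_apply, Finset.sum_mul, btmul_sum, c.objRow_smul, sum_btmul,
      ← btmul_balanced, coe_restrictZero, mul_assoc]
    -- Moving r across the tensor sign has been reduced to r U = U Φ(Ψ(r)); only the order of
    -- summation differs.
    exact Finset.sum_comm_cycle.trans (Finset.sum_congr rfl fun _ _ => Finset.sum_comm)

theorem cornerTensorInv_btmul (q : Q) (m : M) (a : A) :
    cornerTensorInv M c V q (btmul 𝒜 M m a) =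
      ∑ p, ∑ p', btmul ℬ _ (c.objRow M p m) (Ψ a p p' * V q p') :=
  cornerTensorInvPre_apply M c V q a m

variable {V}

theorem cornerTensorInv_mem (hV : ∀ q p, V q p ∈ ℬ 0) (q : Q) (γ : Γ) (y : BalancedTensor 𝒜 M)
    (hy : y ∈ btComponent 𝒜 M γ) : cornerTensorInv M c V q y ∈ btComponent ℬ _ γ := by
  unfold btComponent at hy
  induction hy using AddSubgroup.closure_induction with
  | mem y h =>
    obtain ⟨m, a, ha, rfl⟩ := h
    rw [cornerTensorInv_btmul]
    refine sum_mem fun p _ => sum_mem fun p' _ => btmul_mem _ _ ?_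
    simpa using SetLike.GradedMul.mul_mem (hΨ γ a ha p p') (hV q p')
  | zero => rw [map_zero]; exact zero_mem _
  | add x y _ _ hx hy => rw [map_add]; exact add_mem hx hy
  | neg x _ hx => rw [map_neg]; exact neg_mem hx

/-- The composite sends m ⊗ a to m ⊗ U Φ(Ψ(a)) Φ(V_q). By `hU` this is m ⊗ a U Φ(V_q), and the
triangle identity `hT` turns U Φ(V_q) into the q-th row of Φ(1). -/
theorem cornerTensor_cornerTensorInv (hU : ∀ a p' q', a * (c.U p' q' : A) =
      ∑ p, ∑ q, (c.U p q : A) * Φ (Ψ a p p') q q')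
    (hT : ∀ q q', ∑ p, ∑ s, (c.U p s : A) * Φ (V q p) s q' = Φ 1 q q')
    (q : Q) (y : BalancedTensor 𝒜 M) :
    cornerTensor Φ hΦ M (cornerTensorInv M c V q y) = cornerSingle Φ q y := by
  refine DFunLike.congr_fun (f := (cornerTensor Φ hΦ M).comp (cornerTensorInv M c V q))
    (bt_addHom_ext _ fun m a => ?_) y
  refine Subtype.ext (funext fun q' => ?_)
  rw [AddMonoidHom.comp_apply, cornerTensorInv_btmul]
  simp only [map_sum, cornerTensor_btmul, AddSubgroup.val_finsetSum, Finset.sum_apply,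
    cornerTensorPre_apply]
  change _ = op (Φ 1 q q') • btmul 𝒜 M m a
  have h (p : P) (s : Q) : (c.objRow M p m).1 s = op (c.U p s) • m := rfl
  simp only [op_smul_btmul, h, ← btmul_balanced, ← btmul_sum]
  congr 1
  rw [← hT]
  simp only [Finset.mul_sum, ← mul_assoc, hU, map_mul, Matrix.mul_apply, Finset.sum_mul]
  exact Finset.sum_comm.trans (Finset.sum_congr rfl fun _ _ => Finset.sum_comm_cycle)

/-- Here `hU` lets b pass through V. What remains is to recover x from the rows x_r U_p with
coefficients V, and the same triangle identity `hT` does this. -/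
theorem cornerTensorInv_cornerTensor (hU : ∀ b r p, V r p * b =
      ∑ q, ∑ p', Ψ (Φ b r q) p p' * V q p') (hV : ∀ q p, V q p ∈ ℬ 0)
    (hT : ∀ q q', ∑ p, ∑ s, (c.U p s : A) * Φ (V q p) s q' = Φ 1 q q')
    (z : BalancedTensor ℬ ((cornerFunctor (restrictZero Φ hΦ)).obj M)) :
    ∑ q, cornerTensorInv M c V q ((cornerTensor Φ hΦ M z).1 q) = z := by
  let f : BalancedTensor ℬ ((cornerFunctor (restrictZero Φ hΦ)).obj M) →+
      BalancedTensor ℬ ((cornerFunctor (restrictZero Φ hΦ)).obj M) :=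
    ∑ q, (cornerTensorInv M c V q).comp ((Pi.evalAddMonoidHom _ q).comp
      ((corner Φ (BalancedTensor 𝒜 M)).subtype.comp (cornerTensor Φ hΦ M)))
  have hf (z) : f z = ∑ q, cornerTensorInv M c V q ((cornerTensor Φ hΦ M z).1 q) := by
    simp [f]
  rw [← hf]
  refine DFunLike.congr_fun (g := AddMonoidHom.id _) (bt_addHom_ext _ fun x b => ?_) z
  rw [hf, AddMonoidHom.id_apply, cornerTensor_btmul]
  simp only [cornerTensorPre_apply, map_sum, cornerTensorInv_btmul, ← btmul_sum]
  -- This is x = x Φ(1), with Φ(1) rewritten by `hT`.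
  have hx : x = ∑ r, ∑ p, op (⟨V r p, hV r p⟩ : ℬ 0) • c.objRow M p (x.1 r) := by
    refine Subtype.ext (funext fun q' => ?_)
    refine (congrFun (mem_corner.1 x.2) q').symm.trans ?_
    change _ = (AddSubgroup.subtype (corner (restrictZero Φ hΦ) M) (∑ r, ∑ p,
      op (⟨V r p, hV r p⟩ : ℬ 0) • c.row p (x.1 r))) q'
    simp only [map_sum, Finset.sum_apply, AddSubgroup.subtype_apply, corner_smul_apply,
      c.row_apply, ← mul_smul, ← op_mul, ← Finset.sum_smul, ← Finset.op_sum, rowMul]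
    refine Finset.sum_congr rfl fun r _ => congrArg (fun a : 𝒜 0 => op a • x.1 r) ?_
    refine Subtype.ext ((hT r q').symm.trans ?_)
    simp [coe_restrictZero]
  conv_rhs => rw [hx]
  simp only [sum_btmul, ← btmul_balanced, hU, btmul_sum]
  refine Finset.sum_comm.trans (Finset.sum_congr rfl fun r _ => ?_)
  exact Finset.sum_comm

variable (V) in
/-- Corners commute with `- ⊗_{A₀} A`. -/
def cornerTensorIso (hU : ∀ a p' q', a * (c.U p' q' : A) =
      ∑ p, ∑ q, (c.U p q : A) * Φ (Ψ a p p') q q')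
    (hV : ∀ b r p, V r p * b = ∑ q, ∑ p', Ψ (Φ b r q) p p' * V q p')
    (hV₀ : ∀ q p, V q p ∈ ℬ 0)
    (hT : ∀ q q', ∑ p, ∑ s, (c.U p s : A) * Φ (V q p) s q' = Φ 1 q q') :
    (grCornerFunctor Φ hΦ).obj (tensorObj 𝒜 M) ≅
      tensorObj ℬ ((cornerFunctor (restrictZero Φ hΦ)).obj M) :=
  let f : BalancedTensor ℬ ((cornerFunctor (restrictZero Φ hΦ)).obj M) ≃ₗ[Bᵐᵒᵖ]
      corner Φ (BalancedTensor 𝒜 M) :=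
    { cornerTensor Φ hΦ M with
      map_smul' := fun b y => cornerTensor_smul Φ hΦ M b.unop y
      invFun := fun y => ∑ q, cornerTensorInv M c V q (y.1 q)
      left_inv := cornerTensorInv_cornerTensor M c hV hV₀ hT
      right_inv := fun y => by
        change cornerTensor Φ hΦ M (∑ q, cornerTensorInv M c V q (y.1 q)) = y
        rw [map_sum, Finset.sum_congr rfl fun q _ =>
          cornerTensor_cornerTensorInv M c hU hT q (y.1 q)]
        exact sum_cornerSingle y }
  Iso.symm <| GrMod.isoMk (M := tensorObj ℬ ((cornerFunctor (restrictZero Φ hΦ)).obj M))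
    (N := (grCornerFunctor Φ hΦ).obj (tensorObj 𝒜 M)) f
    (fun γ z hz => by
      let K : AddSubgroup (corner Φ (BalancedTensor 𝒜 M)) :=
        cornerComponent Φ (tensorObj 𝒜 M) γ
      refine (AddSubgroup.closure_le (K.comap (cornerTensor Φ hΦ M))).2 ?_ hz
      rintro _ ⟨x, b, hb, rfl⟩
      exact fun q' => sum_mem fun q _ => btmul_mem _ _ (hΦ γ b hb q q'))
    (fun γ y hy => sum_mem fun q _ => cornerTensorInv_mem M c hV₀ q γ _ (hy q))

/-- Corners define homogeneous graded equivalences. -/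
theorem homogeneouslyGradedEquivalent_of_cornerUnit
    (hΦ : ∀ (γ : Γ) (b : B), b ∈ ℬ γ → ∀ q q', Φ b q q' ∈ 𝒜 γ)
    (hΨ : ∀ (γ : Γ) (a : A), a ∈ 𝒜 γ → ∀ p p', Ψ a p p' ∈ ℬ γ)
    (c : CornerUnit Φ Ψ) (hU : ∀ p q, c.U p q ∈ 𝒜 0) (hV : ∀ p q, c.V p q ∈ 𝒜 0)
    (c' : CornerUnit Ψ Φ) (hU' : ∀ q p, c'.U q p ∈ ℬ 0) (hV' : ∀ q p, c'.V q p ∈ ℬ 0)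
    (hT : ∀ q q', ∑ p, ∑ s, c.U p s * Φ (c'.V q p) s q' = Φ 1 q q') :
    HomogeneouslyGradedEquivalent 𝒜 ℬ :=
  ⟨grCornerFunctor Φ hΦ,
    ⟨grCornerFunctor_isGraded Φ hΦ, grCornerFunctor Ψ hΨ, grCornerFunctor_isGraded Ψ hΨ,
      ⟨c.grFunctorIso hU hV⟩, ⟨c'.grFunctorIso hU' hV'⟩⟩,
    cornerFunctor (restrictZero Φ hΦ),
    cornerFunctor_isEquivalence (c.restrictZero (hΨ := hΨ) hU hV) (c'.restrictZero hU' hV'),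
    fun M => ⟨cornerTensorIso M (c.restrictZero (hΨ := hΨ) hU hV) c'.V c.mul_row c'.col_mul hV' hT⟩⟩

end CornerTensor

/-! ## Graded matrix algebras -/

section GradedMatrix

variable {k : Type u} [Field k] {A B : Type u} [Ring A] [Algebra k A] [Ring B] [Algebra k B]
variable {P Q : Type u} [Fintype P] [DecidableEq P] [Fintype Q] [DecidableEq Q]

/-- An isomorphism of a graded algebra with a matrix algebra in which the matrix unit with indices
`p`, `q` has degree `d p - d q`. -/
structure GradedMatrixIso (𝒜 : ℤ → Submodule k A) (d : P → ℤ) where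
  equiv : A ≃ₐ[k] Matrix P P k
  mem_iff : ∀ n a, a ∈ 𝒜 n ↔ ∀ p q, equiv a p q ≠ 0 → d p = n + d q

namespace GradedMatrixIso

variable {𝒜 : ℤ → Submodule k A} {d : P → ℤ} (ρ : GradedMatrixIso 𝒜 d)
variable {ℬ : ℤ → Submodule k B} {d' : Q → ℤ} (ρ' : GradedMatrixIso ℬ d')

/-- The matrix units. -/
def e (p q : P) : A := ρ.equiv.symm (Matrix.single p q 1)

theorem equiv_e (p q : P) : ρ.equiv (ρ.e p q) = Matrix.single p q 1 :=
  ρ.equiv.apply_symm_apply _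

theorem e_mul_e (p q r s : P) : ρ.e p q * ρ.e r s = if q = r then ρ.e p s else 0 := by
  apply ρ.equiv.injective
  rw [map_mul, equiv_e, equiv_e]
  split_ifs with h
  · subst h
    rw [Matrix.single_mul_single_same, equiv_e, mul_one]
  · rw [Matrix.single_mul_single_of_ne _ _ _ _ h, map_zero]

theorem e_mem_iff (p q : P) (n : ℤ) : ρ.e p q ∈ 𝒜 n ↔ d p = n + d q := by
  rw [ρ.mem_iff]
  simp only [equiv_e]
  constructor
  · intro h
    exact h p q (by simp)
  · intro h p' q' h'
    rw [Matrix.single_apply] at h'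
    obtain ⟨rfl, rfl⟩ := (ite_ne_right_iff.1 h').1
    exact h

theorem mul_e (a : A) (p' s : P) : a * ρ.e p' s = ∑ p, ρ.equiv a p p' • ρ.e p s := by
  apply ρ.equiv.injective
  rw [map_mul, equiv_e, map_sum]
  ext i j
  simp [equiv_e, Matrix.sum_apply, Matrix.single_apply, Matrix.mul_apply, ite_and]

theorem e_mul (a : A) (s p : P) : ρ.e s p * a = ∑ q, ρ.equiv a p q • ρ.e s q := by
  apply ρ.equiv.injective
  rw [map_mul, equiv_e, map_sum]
  ext i j
  simp [equiv_e, Matrix.sum_apply, Matrix.single_apply, Matrix.mul_apply, ite_and]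

theorem sum_e : ∑ p, ρ.e p p = 1 := by
  apply ρ.equiv.injective
  rw [map_sum, map_one]
  ext i j
  simp [equiv_e, Matrix.sum_apply, Matrix.single_apply, Matrix.one_apply, ite_and]

theorem e_mul_mul_e (a : A) (p q r s : P) :
    ρ.e p q * a * ρ.e r s = ρ.equiv a q r • ρ.e p s := by
  rw [e_mul, Finset.sum_mul]
  simp [e_mul_e]

/-- The homomorphism sending a matrix unit with indices `q`, `q'` to the matrix with the single
entry `e_{f q, f q'}`. -/
def transfer (f : Q → P) : B →ₙ+* Matrix Q Q A where
  toFun b := Matrix.of fun q q' => ρ'.equiv b q q' • ρ.e (f q) (f q')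
  map_mul' b b' := by
    ext q q'
    simp [Matrix.mul_apply, Finset.sum_smul, e_mul_e, smul_smul, mul_comm]
  map_zero' := by ext q q'; simp
  map_add' b b' := by ext q q'; simp [add_smul]

theorem transfer_apply (f : Q → P) (b : B) (q q' : Q) :
    ρ.transfer ρ' f b q q' = ρ'.equiv b q q' • ρ.e (f q) (f q') := rfl

/-- As f preserves degrees, e_{f q, f q'} has the degree d' q - d' q' of the unit that it replaces.
-/
theorem transfer_mem {f : Q → P} (hf : ∀ q, d (f q) = d' q) (n : ℤ) (b : B) (hb : b ∈ ℬ n)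
    (q q' : Q) : ρ.transfer ρ' f b q q' ∈ 𝒜 n := by
  rw [transfer_apply]
  by_cases h : ρ'.equiv b q q' = 0
  · rw [h, zero_smul]
    exact zero_mem _
  · refine Submodule.smul_mem _ _ ?_
    rw [e_mem_iff, hf, hf]
    exact (ρ'.mem_iff n b).1 hb q q' h

/-- The unit of the Morita equivalence of two matrix algebras. -/
def cornerUnit (f : Q → P) (g : P → Q) :
    CornerUnit (ρ.transfer ρ' f) (ρ'.transfer ρ g) where
  -- In row p only the entry at q = g p survives, so UV is the sum of the products e_{p, f(g p)}
  -- e_{f(g p), p} = e_{pp}, which is 1.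
  U p q := if q = g p then ρ.e p (f q) else 0
  V p q := if q = g p then ρ.e (f q) p else 0
  sum_mul := by simp [e_mul_e, sum_e]
  mul_eq p q p' q' := by
    rw [transfer_apply, transfer_apply, map_smul, equiv_e, map_one, Matrix.smul_apply,
      Matrix.one_apply]
    by_cases h : p = p' <;> by_cases h₁ : q = g p <;> by_cases h₂ : q' = g p' <;>
      simp_all [e_mul_e, eq_comm]
  mul_row r p' q' := by
    simp only [transfer_apply, map_smul, equiv_e, Matrix.smul_apply, ite_mul, zero_mul,
      Finset.sum_ite_eq', Finset.mem_univ, if_true]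
    by_cases h : q' = g p'
    · subst h
      rw [if_pos rfl, mul_e]
      simp [e_mul_e]
    · simp [h, Ne.symm h]
  col_mul r p q := by
    simp only [transfer_apply, map_smul, equiv_e, Matrix.smul_apply, mul_ite, mul_zero,
      Finset.sum_ite_eq', Finset.mem_univ, if_true]
    by_cases h : q = g p
    · subst h
      rw [if_pos rfl, e_mul]
      simp [e_mul_e]
    · simp [h, Ne.symm h]

-- Neither map has to be injective: how often a degree occurs is irrelevant, as Morita equivalence
-- ignores the sizes of the matrix blocks. The entries e_{p, f(g p)} of U have degree zero because d
-- (f (g p)) = d p.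
include ρ ρ' in
theorem homogeneouslyGradedEquivalent [GradedAlgebra 𝒜] [GradedAlgebra ℬ] (f : Q → P) (g : P → Q)
    (hf : ∀ q, d (f q) = d' q) (hg : ∀ p, d' (g p) = d p) :
    HomogeneouslyGradedEquivalent 𝒜 ℬ := by
  refine homogeneouslyGradedEquivalent_of_cornerUnit (ρ.transfer_mem ρ' hf) (ρ'.transfer_mem ρ hg)
    (ρ.cornerUnit ρ' f g) ?_ ?_ (ρ'.cornerUnit ρ g f) ?_ ?_ ?_
  iterate 4
    intro p q
    dsimp only [cornerUnit]
    split_ifs with h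
    · subst h
      simp [e_mem_iff, hf, hg]
    · exact zero_mem _
  intro q q'
  simp only [cornerUnit, transfer_apply, map_one, Matrix.one_apply]
  -- The row of V indexed by q is supported at p = f q.
  rw [Finset.sum_eq_single (f q)]
  · by_cases h : q = q'
    · subst h
      simp [e_mul_e, equiv_e]
    · simp [h, equiv_e]
  · intro p _ hp
    simp [hp]
  · simp

end GradedMatrixIso

end GradedMatrix

/-! ## Simple modules over the component of degree zero -/

/-- A faithful functor that preserves monomorphisms and zero morphisms and reflects isomorphisms
reflects simple objects. -/
theorem CategoryTheory.Simple.of_map {C D : Type*} [Category C] [Category D]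
    [Limits.HasZeroMorphisms C] [Limits.HasZeroMorphisms D] (F : C ⥤ D)
    [F.PreservesZeroMorphisms] [F.Faithful] [F.PreservesMonomorphisms] [F.ReflectsIsomorphisms]
    (X : C) [Simple (F.obj X)] : Simple X where
  mono_isIso_iff_nonzero f _ := by
    rw [← isIso_iff_of_reflects_iso f F, Simple.mono_isIso_iff_nonzero (F.map f), Ne,
      F.map_eq_zero_iff]

/-- The quasi-inverse reflects simple objects, and it sends F X to an object isomorphic to X. -/
theorem CategoryTheory.Simple.map_of_isEquivalence {C D : Type*} [Category C] [Category D]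
    [Limits.HasZeroMorphisms C] [Limits.HasZeroMorphisms D] (F : C ⥤ D) [F.IsEquivalence]
    (X : C) [Simple X] : Simple (F.obj X) := by
  have : Simple (F.inv.obj (F.obj X)) :=
    Simple.of_iso (Y := X) (F.asEquivalence.unitIso.symm.app X)
  exact Simple.of_map F.inv (F.obj X)

namespace GradedMatrixIso

open MulOpposite

variable {k : Type u} [Field k] {A B : Type u} [Ring A] [Algebra k A] [Ring B] [Algebra k B]
variable {P Q : Type u} [Fintype P] [DecidableEq P] [Fintype Q] [DecidableEq Q]
variable {𝒜 : ℤ → Submodule k A} {d : P → ℤ} (ρ : GradedMatrixIso 𝒜 d)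
variable {ℬ : ℤ → Submodule k B} {d' : Q → ℤ} (ρ' : GradedMatrixIso ℬ d')
theorem e_ne_zero (p q : P) : ρ.e p q ≠ 0 := by
  intro h
  have := congrFun (congrFun (congrArg ρ.equiv h) p) q
  simp [equiv_e] at this

/-- A matrix unit of degree zero. -/
def e₀ (p q : P) (h : d p = d q) : 𝒜 0 := ⟨ρ.e p q, (ρ.e_mem_iff p q 0).2 (by rw [h, zero_add])⟩

theorem e₀_ne_zero (p q : P) (h : d p = d q) : ρ.e₀ p q h ≠ 0 :=
  fun h' => ρ.e_ne_zero p q (congrArg Subtype.val h')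

variable [GradedAlgebra 𝒜] [GradedAlgebra ℬ]

theorem e₀_mul_e₀ (p q r : P) (h : d p = d q) (h' : d q = d r) :
    ρ.e₀ p q h * ρ.e₀ q r h' = ρ.e₀ p r (h.trans h') :=
  Subtype.ext (by simp [e₀, e_mul_e])

/-- The right module `e_{pp} A₀`. -/
abbrev simpleModule (p : P) : Submodule (𝒜 0)ᵐᵒᵖ (𝒜 0)ᵐᵒᵖ :=
  Submodule.span _ {op (ρ.e₀ p p rfl)}

theorem mem_simpleModule {p : P} {x : (𝒜 0)ᵐᵒᵖ} :
    x ∈ ρ.simpleModule p ↔ ∃ a : 𝒜 0, op (ρ.e₀ p p rfl * a) = x := by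
  rw [Submodule.mem_span_singleton]
  exact ⟨fun ⟨a, ha⟩ => ⟨a.unop, ha⟩, fun ⟨a, ha⟩ => ⟨op a, ha⟩⟩

/-- The matrix unit `e_{pp}`, as an element of `e_{pp} A₀`. -/
def simpleGen (p : P) : ρ.simpleModule p :=
  ⟨op (ρ.e₀ p p rfl), Submodule.mem_span_singleton_self _⟩

theorem smul_simpleGen_surjective (p : P) (x : ρ.simpleModule p) :
    ∃ r : (𝒜 0)ᵐᵒᵖ, r • ρ.simpleGen p = x := by
  obtain ⟨a, ha⟩ := ρ.mem_simpleModule.1 x.2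
  exact ⟨op a, Subtype.ext ha⟩

theorem simpleGen_ne_zero (p : P) : ρ.simpleGen p ≠ 0 := fun h =>
  ρ.e₀_ne_zero p p rfl (op_injective (congrArg Subtype.val h))

/-- A nonzero element e_{pp} a has a nonzero coefficient a_{pq}. As a has degree zero, p and q have
equal degree, so e_{qp} lies in A₀, and multiplication by a_{pq}⁻¹ e_{qp} returns the generator
e_{pp}. -/
instance isSimpleModule_simpleModule (p : P) : IsSimpleModule (𝒜 0)ᵐᵒᵖ (ρ.simpleModule p) := by
  rw [isSimpleModule_iff_toSpanSingleton_surjective]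
  refine ⟨⟨_, _, ρ.simpleGen_ne_zero p⟩, fun x hx y => ?_⟩
  obtain ⟨s, rfl⟩ := ρ.smul_simpleGen_surjective p y
  suffices ∃ r : (𝒜 0)ᵐᵒᵖ, r • x = ρ.simpleGen p by
    obtain ⟨r, hr⟩ := this
    exact ⟨s * r, by rw [LinearMap.toSpanSingleton_apply, mul_smul, hr]⟩
  obtain ⟨a, ha⟩ := ρ.mem_simpleModule.1 x.2
  have : ρ.e p p * a ≠ 0 := fun h => hx (Subtype.ext (by
    rw [← ha]
    exact congrArg op (Subtype.ext h)))
  rw [e_mul] at this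
  obtain ⟨q, -, hq⟩ := Finset.exists_ne_zero_of_sum_ne_zero this
  have hq := left_ne_zero_of_smul hq
  have hd : d q = d p := by
    have := (ρ.mem_iff 0 a).1 a.2 p q hq
    rw [this, zero_add]
  refine ⟨op ((ρ.equiv a p q)⁻¹ • ρ.e₀ q p hd), Subtype.ext ?_⟩
  change _ • x.1 = _
  rw [← ha]
  refine congrArg op (Subtype.ext ?_)
  change ρ.e p p * (a : A) * ((ρ.equiv a p q)⁻¹ • ρ.e q p) = ρ.e p p
  rw [mul_smul_comm, e_mul_mul_e, smul_smul, inv_mul_cancel₀ hq, one_smul]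

/-- The map a ↦ n a on e_{pp} A₀ takes the generator to n e_{pp}. -/
theorem exists_hom_ne_zero {N : Type*} [AddCommGroup N] [Module (𝒜 0)ᵐᵒᵖ N] {p : P} {n : N}
    (h : op (ρ.e₀ p p rfl) • n ≠ 0) : ∃ f : ρ.simpleModule p →ₗ[(𝒜 0)ᵐᵒᵖ] N, f ≠ 0 :=
  ⟨(LinearMap.toSpanSingleton (𝒜 0)ᵐᵒᵖ N n).domRestrict (ρ.simpleModule p), fun hf =>
    h (LinearMap.congr_fun hf (ρ.simpleGen p))⟩

/-- An isomorphism sends the generator to a nonzero element of e_{qq} A₀ e_{pp}, which exists only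
if the degrees agree. If they do, e_{qp} gives a nonzero map, bijective by Schur's lemma. -/
theorem simpleModule_equiv_iff (p q : P) :
    Nonempty (ρ.simpleModule p ≃ₗ[(𝒜 0)ᵐᵒᵖ] ρ.simpleModule q) ↔ d p = d q := by
  constructor
  · rintro ⟨f⟩
    obtain ⟨a, ha⟩ := ρ.mem_simpleModule.1 (f (ρ.simpleGen p)).2
    -- The generator is fixed by e_{pp} on the right, hence so is its image.
    have h₁ : op (ρ.e₀ p p rfl) • ρ.simpleGen p = ρ.simpleGen p :=
      Subtype.ext (congrArg op (ρ.e₀_mul_e₀ p p p rfl rfl))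
    have h₂ : op (ρ.e₀ q q rfl * a * ρ.e₀ p p rfl) = (f (ρ.simpleGen p)).1 := by
      rw [← h₁, map_smul]
      change _ = _ • (f (ρ.simpleGen p)).1
      rw [← ha]
      rfl
    have h₃ : ρ.e q q * a * ρ.e p p ≠ 0 := fun h => by
      refine (f.map_ne_zero_iff.2 (ρ.simpleGen_ne_zero p)) (Subtype.ext ?_)
      rw [← h₂]
      exact congrArg op (Subtype.ext h)
    rw [e_mul_mul_e] at h₃
    have := (ρ.mem_iff 0 a).1 a.2 q p (left_ne_zero_of_smul h₃)
    rw [this, zero_add]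
  · intro h
    let n : ρ.simpleModule q := ⟨op (ρ.e₀ q p h.symm),
      ρ.mem_simpleModule.2 ⟨_, congrArg op (ρ.e₀_mul_e₀ q q p rfl h.symm)⟩⟩
    obtain ⟨f, hf⟩ := ρ.exists_hom_ne_zero (p := p) (n := n) fun hn => by
      refine ρ.e₀_ne_zero q p h.symm (op_injective ?_)
      rw [← ρ.e₀_mul_e₀ q p p h.symm rfl]
      exact congrArg Subtype.val hn
    have hb := LinearMap.bijective_of_ne_zero (R := (𝒜 0)ᵐᵒᵖ) (M := ρ.simpleModule p)
      (N := ρ.simpleModule q) hf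
    exact ⟨LinearEquiv.ofBijective f hb⟩

/-- Since 1 = ∑ e_{pp}, some e_{pp} does not kill a given nonzero n, and the nonzero map obtained
from it is bijective by Schur's lemma. -/
theorem exists_simpleModule_equiv (N : Type*) [AddCommGroup N] [Module (𝒜 0)ᵐᵒᵖ N]
    [IsSimpleModule (𝒜 0)ᵐᵒᵖ N] : ∃ p, Nonempty (ρ.simpleModule p ≃ₗ[(𝒜 0)ᵐᵒᵖ] N) := by
  have := IsSimpleModule.nontrivial (𝒜 0)ᵐᵒᵖ N
  obtain ⟨n, hn⟩ := exists_ne (0 : N)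
  have h : ∑ p, op (ρ.e₀ p p rfl) = 1 := by
    rw [← Finset.op_sum, op_eq_one_iff]
    refine Subtype.ext ?_
    rw [AddSubmonoidClass.coe_finsetSum]
    exact ρ.sum_e
  rw [← one_smul (𝒜 0)ᵐᵒᵖ n, ← h, Finset.sum_smul] at hn
  obtain ⟨p, -, hp⟩ := Finset.exists_ne_zero_of_sum_ne_zero hn
  obtain ⟨f, hf⟩ := ρ.exists_hom_ne_zero hp
  have hb := LinearMap.bijective_of_ne_zero (R := (𝒜 0)ᵐᵒᵖ) (M := ρ.simpleModule p) (N := N) hf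
  exact ⟨p, ⟨LinearEquiv.ofBijective f hb⟩⟩

-- The values of d label the isomorphism classes of simple modules. An equivalence preserves
-- simplicity and reflects isomorphism, so it injects the classes over A₀ into those over B₀.
include ρ ρ' in
theorem card_image_le (η : ModuleCat.{u} (𝒜 0)ᵐᵒᵖ ⥤ ModuleCat.{u} (ℬ 0)ᵐᵒᵖ) [η.IsEquivalence] :
    (Finset.univ.image d).card ≤ (Finset.univ.image d').card := by
  have h (p : P) : ∃ q, Nonempty (ρ'.simpleModule q ≃ₗ[(ℬ 0)ᵐᵒᵖ]
      η.obj (ModuleCat.of _ (ρ.simpleModule p))) := by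
    have := Simple.map_of_isEquivalence η (ModuleCat.of _ (ρ.simpleModule p))
    exact ρ'.exists_simpleModule_equiv _
  choose g hg using h
  have hinj (p p' : P) (h : d' (g p) = d' (g p')) : d p = d p' := by
    obtain ⟨f₁⟩ := hg p
    obtain ⟨f₂⟩ := hg p'
    obtain ⟨f⟩ := (ρ'.simpleModule_equiv_iff _ _).2 h
    exact (ρ.simpleModule_equiv_iff _ _).1
      ⟨(η.preimageIso (f₁.symm.trans (f.trans f₂)).toModuleIso).toLinearEquiv⟩
  have hs (i : ℤ) (hi : i ∈ Finset.univ.image d) : ∃ p, d p = i := by simpa using hi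
  cases isEmpty_or_nonempty P
  · simp
  choose! s hs using hs
  refine Finset.card_le_card_of_injOn (fun i => d' (g (s i))) (fun i _ => by simp) ?_
  intro i hi j hj h
  rw [← hs i hi, ← hs j hj]
  exact hinj _ _ h

include ρ ρ' in
theorem card_image_eq (h : HomogeneouslyGradedEquivalent 𝒜 ℬ) :
    (Finset.univ.image d).card = (Finset.univ.image d').card := by
  obtain ⟨-, -, η, hη, -⟩ := h
  exact le_antisymm (ρ.card_image_le ρ' η) (ρ'.card_image_le ρ η.inv)

end GradedMatrixIso

/-! ### The set of path lengths -/

section PathLengths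

variable {E : Type u} [Quiver.{u} E] {v : E}

theorem exists_isGreatest_pathLengthsTo [Finite (Σ a, PathTo v a)] :
    ∃ m, IsGreatest (pathLengthsTo v) m := by
  have h : pathLengthsTo v = Set.range fun p : Σ a, PathTo v a => p.2.length :=
    Set.ext fun n => PathTo.mem_pathLengthsTo
  rw [h]
  have : Nonempty (Σ a, PathTo v a) := ⟨⟨v, .nil⟩⟩
  obtain ⟨p, hp⟩ := Finite.exists_max fun p : Σ a, PathTo v a => p.2.length
  exact ⟨_, ⟨p, rfl⟩, by rintro _ ⟨q, rfl⟩; exact hp q⟩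

theorem exists_length_eq_iff {m : ℕ} (hm : IsGreatest (pathLengthsTo v) m) (n : ℕ) :
    (∃ p : Σ a, PathTo v a, p.2.length = n) ↔ n ≤ m := by
  constructor
  · exact fun h => hm.2 (PathTo.mem_pathLengthsTo.2 h)
  · intro h
    obtain ⟨⟨a, p⟩, rfl⟩ := PathTo.mem_pathLengthsTo.1 hm.1
    exact p.exists_length_eq_of_le h

/-- The lengths fill the interval from 0 to m; the trivial path accounts for the extra one. -/
theorem card_image_length [Fintype (Σ a, PathTo v a)] {m : ℕ}
    (hm : IsGreatest (pathLengthsTo v) m) :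
    (Finset.univ.image fun p : Σ a, PathTo v a => (p.2.length : ℤ)).card = m + 1 := by
  have : (Finset.univ.image fun p : Σ a, PathTo v a => (p.2.length : ℤ)) =
      (Finset.range (m + 1)).map Nat.castEmbedding := by
    ext i
    simp only [Finset.mem_image, Finset.mem_univ, true_and, Finset.mem_map, Finset.mem_range,
      Nat.castEmbedding_apply, Nat.lt_succ_iff, ← exists_length_eq_iff hm]
    aesop
  rw [this, Finset.card_map, Finset.card_range]

end PathLengths

/-! ### The classification -/

theorem mainTheorem10 (k E F : Type u) [Field k]
    [Quiver.{u} E] [Fintype E] [∀ a b : E, Fintype (a ⟶ b)]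
    [Quiver.{u} F] [Fintype F] [∀ a b : F, Fintype (a ⟶ b)]
    (hE : IsAcyclicGraph E) (hF : IsAcyclicGraph F)
    (v : E) (hv : ∀ x : E, IsSink x ↔ x = v)
    (w : F) (hw : ∀ x : F, IsSink x ↔ x = w) :
    ∃ m n : ℕ, IsGreatest (pathLengthsTo v) m ∧ IsGreatest (pathLengthsTo w) n ∧
      (HomogeneouslyGradedEquivalent (LeavittPathAlgebra.grading k E)
          (LeavittPathAlgebra.grading k F) ↔ m = n) := by
  classical
  have := PathTo.finite hE v
  have := PathTo.finite hF w
  have := Fintype.ofFinite (Σ a, PathTo v a)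
  have := Fintype.ofFinite (Σ a, PathTo w a)
  obtain ⟨m, hm⟩ := exists_isGreatest_pathLengthsTo (v := v)
  obtain ⟨n, hn⟩ := exists_isGreatest_pathLengthsTo (v := w)
  let ρ : GradedMatrixIso (LeavittPathAlgebra.grading k E)
      (fun p : Σ a, PathTo v a => (p.2.length : ℤ)) :=
    ⟨LeavittPathAlgebra.pathMatrixEquiv k hE hv, LeavittPathAlgebra.mem_grading_iff hE hv⟩
  let ρ' : GradedMatrixIso (LeavittPathAlgebra.grading k F)
      (fun p : Σ a, PathTo w a => (p.2.length : ℤ)) :=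
    ⟨LeavittPathAlgebra.pathMatrixEquiv k hF hw, LeavittPathAlgebra.mem_grading_iff hF hw⟩
  refine ⟨m, n, hm, hn, fun h => ?_, ?_⟩
  · have := ρ.card_image_eq ρ' h
    rw [card_image_length hm, card_image_length hn] at this
    omega
  · rintro rfl
    -- With a common maximum, both sets of lengths are the same interval, so every length on one
    -- side is matched on the other.
    have hf (q : Σ a, PathTo w a) : ∃ p : Σ a, PathTo v a, p.2.length = q.2.length :=
      (exists_length_eq_iff hm _).2 ((exists_length_eq_iff hn _).1 ⟨q, rfl⟩)
    have hg (p : Σ a, PathTo v a) : ∃ q : Σ a, PathTo w a, q.2.length = p.2.length :=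
      (exists_length_eq_iff hn _).2 ((exists_length_eq_iff hm _).1 ⟨p, rfl⟩)
    choose f hf using hf
    choose g hg using hg
    exact ρ.homogeneouslyGradedEquivalent ρ' f g (fun q => congrArg _ (hf q))
      fun p => congrArg _ (hg p)
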